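/- Let $G$ be a profinite group and $C^\cdot$ a bounded complex of discrete $G$-modules. For an open subgroup $U\le G$ let $H^q(U,C^\cdot)$ denote hypercohomology, i.e. the cohomology of the complex of $U$-invariants of the total complex of the standard resolutions $C(G^{\bullet+1},C^j)$ (continuous homogeneous cochains); for open subgroups $V\le U$ restriction $\mathrm{res}$ is induced by the inclusion of $U$-invariants into $V$-invariants, and corestriction $\mathrm{cor}_{U/V}$ by the norm $\sum_{\sigma\in U/V}\sigma$. The pair $(G,C^\cdot)$ is called a *generalized class formation* if - (C1) $H^1(U,C^\cdot)=0$ for every open subgroup $U$ of $G$; - (C2) there is an isomorphism $\mathrm{inv}_U\colon H^2(U,C^\cdot)\xrightarrow{\sim}\mathbb{Q}/\mathbb{Z}$ for every open subgroup $U$ of $G$; - (C3) $\mathrm{inv}_V\circ\mathrm{res}=|U:V|\cdot\mathrm{inv}_U$ for all open subgroups $V\le U\le G$. For an open subgroup $U$ let $U^{\mathrm{ab}}$ be its topological abelianization, the quotient of $U$ by the closure of its commutator subgroup. **Lemma.** Let $(G,C^\cdot)$ be a generalized class formation, with isomorphisms $\mathrm{inv}_U$ as in (C2), (C3). Then for every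 open subgroup $U$ of $G$ there is a canonical homomorphism $$\rho_U\colon H^0(U,C^\cdot)\to U^{\mathrm{ab}},$$ namely the unique one with $\mathrm{inv}_U(a\cup\delta\chi)=\chi(\rho_U(a))$ for all $a\in H^0(U,C^\cdot)$ and all continuous characters $\chi\colon U^{\mathrm{ab}}\to\mathbb{Q}/\mathbb{Z}$ ($\mathbb{Q}/\mathbb{Z}$ discrete), where $\delta\chi\in H^2(U,\mathbb{Z})$ is the image of $\chi\in H^1(U,\mathbb{Q}/\mathbb{Z})$ under the connecting map of $0\to\mathbb{Z}\to\mathbb{Q}\to\mathbb{Q}/\mathbb{Z}\to0$. The image of $\rho_U$ is dense in $U^{\mathrm{ab}}$, and for every pair of open subgroups $V\le U\le G$ with $V$ normal in $U$ the map $\rho_U$ induces an isomorphism $$H^0(U,C^\cdot)/\mathrm{cor}_{U/V}H^0(V,C^\cdot)\xrightarrow{\sim}(U/V)^{\mathrm{ab}}.$$ -/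

import Mathlib

open CategoryTheory

universe u w

noncomputable section

/-! Throughout, `G` is a topological group and `C` is a complex of `G`-modules, with differentials
of degree `+1`, that is, an object of `CochainComplex (Rep ℤ G) ℤ`. -/

/-- The group `ℚ/ℤ`. -/
abbrev QModZ : Type := AddCircle (1 : ℚ)

namespace Hyper

section Cochains

variable {G : Type u} [Group G] (C : CochainComplex (Rep.{w} ℤ G) ℤ)

/-- A complex of `G`-modules is bounded if it vanishes outside a finite range of degrees. -/
def IsBounded : Prop := ∃ a b : ℤ, C.IsStrictlyGE a ∧ C.IsStrictlyLE b

/-- All modules of the complex are discrete `G`-modules: the stabilizer of each element is open. -/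
def IsDiscrete [TopologicalSpace G] : Prop :=
  ∀ (j : ℤ) (v : C.X j), IsOpen {g : G | (C.X j).ρ g v = v}

/-- Families `x p j` of functions `G^(p+1) → C^j`, for all bidegrees `(p, j)`. -/
abbrev Family : Type (max u w) := ∀ (p : ℕ) (j : ℤ), (Fin (p + 1) → G) → C.X j

variable {C}

/-- The action of `G` on families, `(u x)(g₀, …, g_p) = u • x(u⁻¹ g₀, …, u⁻¹ g_p)`. -/
def act (u : G) : Family C →+ Family C where
  toFun x p j g := (C.X j).ρ u (x p j fun i => u⁻¹ * g i)
  map_zero' := by funext p j g; simp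
  map_add' x y := by funext p j g; simp

/-- The differential in the direction of the group:
`(δ x)(g₀, …, g_{p+1}) = ∑ i, (-1)^i x(g₀, …, ĝ_i, …, g_{p+1})`. -/
def dGroup : Family C →+ Family C where
  toFun x
    | 0, _, _ => 0
    | p + 1, j, g => ∑ i : Fin (p + 2), (-1 : ℤ) ^ (i : ℕ) • x p j fun k => g (i.succAbove k)
  map_zero' := by funext p j g; cases p <;> simp
  map_add' x y := by
    funext p j g
    cases p
    · simp
    · simp [Finset.sum_add_distrib]

/-- The differential in the direction of the complex `C`. -/
def dComplex : Family C →+ Family C where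
  toFun x p j g := (C.d (j - 1) j).hom (x p (j - 1) g)
  map_zero' := by funext p j g; simp
  map_add' x y := by funext p j g; simp

/-- The total differential `δ + (-1)^p d_C`. -/
def dTot : Family C →+ Family C where
  toFun x p j g := dGroup x p j g + (-1 : ℤ) ^ p • dComplex x p j g
  map_zero' := by funext p j g; simp
  map_add' x y := by
    funext p j g
    simp only [map_add, Pi.add_apply, smul_add]
    abel

theorem act_apply (u : G) (x : Family C) (p : ℕ) (j : ℤ) (g : Fin (p + 1) → G) :
    act u x p j g = (C.X j).ρ u (x p j fun i => u⁻¹ * g i) := rfl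

theorem dGroup_zero (x : Family C) (j : ℤ) (g : Fin 1 → G) : dGroup x 0 j g = 0 := rfl

theorem dGroup_succ (x : Family C) (p : ℕ) (j : ℤ) (g : Fin (p + 2) → G) :
    dGroup x (p + 1) j g =
      ∑ i : Fin (p + 2), (-1 : ℤ) ^ (i : ℕ) • x p j fun k => g (i.succAbove k) := rfl

theorem dComplex_apply (x : Family C) (p : ℕ) (j : ℤ) (g : Fin (p + 1) → G) :
    dComplex x p j g = (C.d (j - 1) j).hom (x p (j - 1) g) := rfl

theorem dTot_apply (x : Family C) (p : ℕ) (j : ℤ) (g : Fin (p + 1) → G) :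
    dTot x p j g = dGroup x p j g + (-1 : ℤ) ^ p • dComplex x p j g := rfl

theorem act_mul (u v : G) (x : Family C) : act (u * v) x = act u (act v x) := by
  funext p j g
  simp [act_apply, mul_assoc]

theorem act_dTot (u : G) (x : Family C) : act u (dTot x) = dTot (act u x) := by
  funext p j g
  rw [act_apply, dTot_apply, dTot_apply, map_add, map_zsmul]
  congr 1
  · cases p with
    | zero => simp [dGroup_zero]
    | succ p => simp [dGroup_succ, act_apply]
  · rw [dComplex_apply, dComplex_apply, act_apply, Rep.hom_comm_apply]

theorem dTot_dTot (x : Family C) : dTot (dTot x) = 0 := by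
  funext p j g
  have hC : (C.d (j - 1) j).hom ((C.d (j - 1 - 1) (j - 1)).hom (x p (j - 1 - 1) g)) = 0 := by
    rw [← Rep.comp_apply, C.d_comp_d]
    rfl
  rcases p with _ | p
  · simp only [dTot_apply, dGroup_zero, dComplex_apply, pow_zero, one_smul, zero_add, hC]
    rfl
  · have hG : dGroup (dGroup x) (p + 1) j g = 0 := by
      rcases p with _ | p
      · simp [dGroup_succ, dGroup_zero]
      · simp only [dGroup_succ, Finset.smul_sum, smul_smul, ← pow_add]
        rw [← Finset.sum_product']
        refine Finset.sum_involution (fun ij _ => (ij.1.succAbove ij.2, ij.2.predAbove ij.1))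
          ?_ ?_ ?_ ?_
        · rintro ⟨i, k⟩ -
          simp only [Fin.succAbove_succAbove_succAbove_predAbove,
            Fin.neg_one_pow_succAbove_add_predAbove]
          simp
        · rintro ⟨i, k⟩ - - h
          exact Fin.succAbove_ne i k (congr_arg Prod.fst h)
        · simp
        · rintro ⟨i, k⟩ -
          simp [Fin.succAbove_succAbove_predAbove, Fin.predAbove_predAbove_succAbove]
    have hGC : dGroup (fun p j g => (-1 : ℤ) ^ p • dComplex x p j g) (p + 1) j g =
        (-1 : ℤ) ^ p • dComplex (dGroup x) (p + 1) j g := by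
      simp only [dGroup_succ, dComplex_apply, map_sum, map_zsmul, Finset.smul_sum]
      exact Finset.sum_congr rfl fun i _ => smul_comm _ _ _
    have e : dTot x = dGroup x + fun p j g => (-1 : ℤ) ^ p • dComplex x p j g := rfl
    rw [dTot_apply, e, map_add, map_add]
    simp only [Pi.add_apply, hG, hGC, zero_add]
    have hCC : dComplex (fun p j g => (-1 : ℤ) ^ p • dComplex x p j g) (p + 1) j g = 0 := by
      simp only [dComplex_apply, map_zsmul, hC, smul_zero]
    rw [hCC, add_zero, pow_succ]
    simp

/-- The norm `x ↦ ∑ σ x`, where `σ` runs through representatives of `U / V`; on `V`-invariant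
families it does not depend on the representatives. -/
def norm (U V : Subgroup G) [Fintype (U ⧸ V.subgroupOf U)] : Family C →+ Family C :=
  ∑ s : U ⧸ V.subgroupOf U, act (s.out : G)

theorem norm_apply (U V : Subgroup G) [Fintype (U ⧸ V.subgroupOf U)] (x : Family C) :
    norm U V x = ∑ s : U ⧸ V.subgroupOf U, act (s.out : G) x := by
  simp [norm]

theorem dTot_norm (U V : Subgroup G) [Fintype (U ⧸ V.subgroupOf U)] (x : Family C) :
    dTot (norm U V x) = norm U V (dTot x) := by
  simp [norm_apply, act_dTot]

theorem act_eq_of_mk_eq {U V : Subgroup G} {x : Family C} (hx : ∀ v ∈ V, act v x = x) {s t : U}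
    (h : (s : U ⧸ V.subgroupOf U) = t) : act (s : G) x = act (t : G) x := by
  have hv : (s : G)⁻¹ * t ∈ V := by
    simpa [Subgroup.mem_subgroupOf] using QuotientGroup.eq.1 h
  have := act_mul (s : G) ((s : G)⁻¹ * t) x
  rw [hx _ hv, mul_inv_cancel_left] at this
  exact this.symm

/-- The cup product of families with a function `n : G³ → ℤ`:
`(x ∪ n)(g₀, …, g_{p+2}) = n(g_p, g_{p+1}, g_{p+2}) x(g₀, …, g_p)`. -/
def cupFamily (n : G → G → G → ℤ) : Family C →+ Family C where
  toFun x
    | 0, _, _ => 0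
    | 1, _, _ => 0
    | p + 2, j, g => n (g (Fin.last p).castSucc.castSucc) (g (Fin.last (p + 1)).castSucc)
        (g (Fin.last (p + 2))) • x p j fun k => g k.castSucc.castSucc
  map_zero' := by funext p j g; rcases p with _ | _ | p <;> simp
  map_add' x y := by funext p j g; rcases p with _ | _ | p <;> simp

theorem cupFamily_succ_succ (n : G → G → G → ℤ) (x : Family C) (p : ℕ) (j : ℤ)
    (g : Fin (p + 3) → G) : cupFamily n x (p + 2) j g =
      n (g (Fin.last p).castSucc.castSucc) (g (Fin.last (p + 1)).castSucc)
        (g (Fin.last (p + 2))) • x p j fun k => g k.castSucc.castSucc := rfl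

variable [TopologicalSpace G]

variable (C) in
/-- The group `T^q(U)` of `U`-invariant continuous homogeneous cochains of total degree `q`:
families of locally constant functions `G^(p+1) → C^j`, zero unless `p + j = q`, fixed by `U`.
For a bounded complex `C` of discrete modules over a profinite group `G`, the complex `T^•(⊥)` is
the total complex of the standard resolutions `C(G^(•+1), C^j)` of the modules `C^j`. These are
acyclic for every open (indeed every closed) subgroup `U`, so that the complex `T^•(U)` of
`U`-invariants computes the hypercohomology of `U` with coefficients in `C`. -/
def cochains (U : Subgroup G) (q : ℤ) : AddSubgroup (Family C) where
  carrier := {x | (∀ (p : ℕ) (j : ℤ), (p : ℤ) + j ≠ q → x p j = 0) ∧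
    (∀ p j, IsLocallyConstant (x p j)) ∧ ∀ u ∈ U, act u x = x}
  zero_mem' := ⟨fun _ _ _ => rfl, fun _ _ => IsLocallyConstant.const 0, fun _ _ => map_zero _⟩
  add_mem' := by
    rintro x y ⟨h1, h2, h3⟩ ⟨k1, k2, k3⟩
    refine ⟨fun p j h => ?_, fun p j => (h2 p j).add (k2 p j), fun u hu => ?_⟩
    · simp [h1 p j h, k1 p j h]
    · rw [map_add, h3 u hu, k3 u hu]
  neg_mem' := by
    rintro x ⟨h1, h2, h3⟩
    refine ⟨fun p j h => ?_, fun p j => (h2 p j).neg, fun u hu => ?_⟩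
    · simp [h1 p j h]
    · rw [map_neg, h3 u hu]

variable (C) in
/-- The cocycles of total degree `q`. -/
def cocycles (U : Subgroup G) (q : ℤ) : AddSubgroup (Family C) :=
  cochains C U q ⊓ (dTot (C := C)).ker

variable (C) in
/-- The coboundaries of total degree `q`. -/
def coboundaries (U : Subgroup G) (q : ℤ) : AddSubgroup (Family C) :=
  (cochains C U (q - 1)).map (dTot (C := C))

theorem coboundaries_le_cocycles (U : Subgroup G) (q : ℤ) :
    coboundaries C U q ≤ cocycles C U q := by
  rintro _ ⟨x, ⟨h1, h2, h3⟩, rfl⟩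
  refine ⟨⟨fun p j h => ?_, fun p j => ?_, fun u hu => ?_⟩, dTot_dTot x⟩
  · funext g
    rw [dTot_apply, dComplex_apply, h1 p (j - 1) (by lia)]
    rcases p with _ | p
    · simp [dGroup_zero]
    · simp [dGroup_succ, h1 p j (by push_cast at h; lia)]
  · have hc : IsLocallyConstant (dComplex x p j) := (h2 p (j - 1)).comp (C.d (j - 1) j).hom
    refine IsLocallyConstant.add ?_ (hc.comp fun v => (-1 : ℤ) ^ p • v)
    rcases p with _ | p
    · exact IsLocallyConstant.const 0
    · have hs : dGroup x (p + 1) j = ∑ i : Fin (p + 2),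
          fun g => (-1 : ℤ) ^ (i : ℕ) • x p j fun k => g (i.succAbove k) := by
        funext g
        simp [dGroup_succ]
      rw [hs]
      refine Finset.sum_induction _ IsLocallyConstant (fun _ _ h h' => h.add h')
        (IsLocallyConstant.const 0) fun i _ => ?_
      have hi : Continuous fun (g : Fin (p + 2) → G) (k : Fin (p + 1)) => g (i.succAbove k) := by
        fun_prop
      exact ((h2 p j).comp_continuous hi).comp fun v => (-1 : ℤ) ^ (i : ℕ) • v
  · rw [act_dTot, h3 u hu]

variable (C) in
/-- The hypercohomology group `H^q(U, C)`. -/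
abbrev H (U : Subgroup G) (q : ℤ) : Type (max u w) :=
  cocycles C U q ⧸ (coboundaries C U q).addSubgroupOf (cocycles C U q)

/-- The map on hypercohomology given by a homomorphism of families that commutes with the
differential and respects cochains. -/
def mapH {U V : Subgroup G} {q r : ℤ} (φ : Family C →+ Family C)
    (hd : ∀ x, dTot (φ x) = φ (dTot x))
    (h : ∀ x ∈ cochains C U q, φ x ∈ cochains C V r)
    (h' : ∀ x ∈ cochains C U (q - 1), φ x ∈ cochains C V (r - 1)) : H C U q →+ H C V r :=
  QuotientAddGroup.map _ _
    ((φ.comp (cocycles C U q).subtype).codRestrict (cocycles C V r) (by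
      rintro ⟨x, hx, hx'⟩
      refine ⟨h x hx, ?_⟩
      have hx'' : dTot x = 0 := hx'
      change dTot (φ x) = 0
      rw [hd, hx'', map_zero]))
    (by
      rintro ⟨x, hx⟩ hxb
      obtain ⟨y, hy, rfl⟩ : x ∈ coboundaries C U q := AddSubgroup.mem_addSubgroupOf.1 hxb
      rw [AddSubgroup.mem_comap, AddSubgroup.mem_addSubgroupOf]
      exact ⟨φ y, h' y hy, hd y⟩)

/-- The restriction `H^q(U, C) → H^q(V, C)` for `V ≤ U`, induced by the inclusion
`T^•(U) ⊆ T^•(V)`. -/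
def res {U V : Subgroup G} (hVU : V ≤ U) (q : ℤ) : H C U q →+ H C V q :=
  mapH (AddMonoidHom.id _) (fun _ => rfl)
    (fun _ hx => ⟨hx.1, hx.2.1, fun v hv => hx.2.2 v (hVU hv)⟩)
    (fun _ hx => ⟨hx.1, hx.2.1, fun v hv => hx.2.2 v (hVU hv)⟩)

theorem act_mem_locallyConstant [ContinuousMul G] {x : Family C} (u : G)
    (hx : ∀ p j, IsLocallyConstant (x p j)) (p : ℕ) (j : ℤ) :
    IsLocallyConstant (act u x p j) := by
  have hc : Continuous fun (g : Fin (p + 1) → G) (i : Fin (p + 1)) => u⁻¹ * g i := by fun_prop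
  exact ((hx p j).comp_continuous hc).comp ((C.X j).ρ u)

theorem norm_mem [ContinuousMul G] (U V : Subgroup G) [Fintype (U ⧸ V.subgroupOf U)] (q : ℤ)
    (x : Family C) (hx : x ∈ cochains C V q) : norm U V x ∈ cochains C U q := by
  obtain ⟨h1, h2, h3⟩ := hx
  refine ⟨fun p j h => ?_, fun p j => ?_, fun u hu => ?_⟩
  · funext g
    simp [norm_apply, act_apply, Finset.sum_apply, h1 p j h]
  · rw [norm_apply]
    simp only [Finset.sum_apply]
    refine Finset.sum_induction _ IsLocallyConstant (fun _ _ h h' => h.add h')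
      (IsLocallyConstant.const 0) fun s _ => act_mem_locallyConstant _ h2 p j
  · rw [norm_apply, map_sum]
    refine Fintype.sum_equiv (MulAction.toPerm (⟨u, hu⟩ : U)) _ _ fun s => ?_
    rw [← act_mul]
    refine act_eq_of_mk_eq (s := ⟨u, hu⟩ * s.out) h3 ?_
    rw [QuotientGroup.out_eq', MulAction.toPerm_apply]
    conv_rhs => rw [← QuotientGroup.out_eq' s]
    rfl

/-- The corestriction `H^q(V, C) → H^q(U, C)` for subgroups `V ≤ U` of finite index, induced by
the norm `T^•(V) → T^•(U)`. -/
def cor [ContinuousMul G] {U V : Subgroup G} [Finite (U ⧸ V.subgroupOf U)] (_hVU : V ≤ U)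
    (q : ℤ) : H C V q →+ H C U q :=
  letI := Fintype.ofFinite (U ⧸ V.subgroupOf U)
  mapH (norm U V) (dTot_norm U V) (norm_mem U V q) (norm_mem U V (q - 1))

/-- Homogeneous continuous `2`-cocycles of `U` with values in the trivial module `ℤ`, as
`U`-invariant functions on `G³`. -/
structure IntCocycle (U : Subgroup G) where
  toFun : G → G → G → ℤ
  isLocallyConstant : IsLocallyConstant fun g : G × G × G => toFun g.1 g.2.1 g.2.2
  invariant : ∀ u ∈ U, ∀ a b c : G, toFun (u * a) (u * b) (u * c) = toFun a b c
  cocycle : ∀ a b c d : G, toFun b c d - toFun a c d + toFun a b d - toFun a b c = 0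

/-- `n` represents the class `δ χ ∈ H²(U, ℤ)` of the continuous character
`χ : U → ℚ/ℤ`, where `δ` is the connecting map of `0 → ℤ → ℚ → ℚ/ℤ → 0`: there is a `U`-invariant
continuous function `f : G² → ℚ` whose reduction modulo `ℤ` is a `1`-cocycle corresponding to `χ`
and whose coboundary is `n`. -/
def IntCocycle.RepresentsDelta {U : Subgroup G} (n : IntCocycle U)
    (χ : Additive U →+ QModZ) : Prop :=
  ∃ f : G → G → ℚ, (IsLocallyConstant fun g : G × G => f g.1 g.2) ∧
    (∀ u ∈ U, ∀ a b : G, f (u * a) (u * b) = f a b) ∧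
    (∀ u : U, ((f 1 u : ℚ) : QModZ) = χ (Additive.ofMul u)) ∧
    ∀ a b c : G, f b c - f a c + f a b = n.toFun a b c

theorem dTot_cupFamily {U : Subgroup G} (n : IntCocycle U) (x : Family C) :
    dTot (cupFamily n.toFun x) = cupFamily n.toFun (dTot x) := by
  funext p j g
  rcases p with _ | _ | p
  · simp [dTot_apply, dGroup_zero, dComplex_apply, cupFamily]
  · simp [dTot_apply, dGroup_succ, dComplex_apply, cupFamily]
  · rw [cupFamily_succ_succ, dTot_apply, dTot_apply, dComplex_apply, dComplex_apply,
      cupFamily_succ_succ, map_zsmul, smul_add]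
    congr 1
    · rcases p with _ | p
      · simp [dGroup_zero, dGroup_succ, cupFamily]
      · rw [dGroup_succ, dGroup_succ, Fin.sum_univ_castSucc, Fin.sum_univ_castSucc,
          Fin.sum_univ_castSucc]
        simp only [cupFamily_succ_succ]
        rw [Fin.sum_univ_castSucc (n := p + 1), smul_add, Finset.smul_sum]
        have e1 : ∀ (i : Fin (p + 1)) (k : Fin (p + 1)),
            i.castSucc.castSucc.castSucc.succAbove k.castSucc.castSucc =
              (i.castSucc.succAbove k).castSucc.castSucc := by
          intro i k
          ext
          simp only [Fin.succAbove, Fin.lt_def, Fin.val_castSucc]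
          split_ifs <;> simp
        have e2 : ∀ i : Fin (p + 1), i.castSucc.succAbove (Fin.last p) = Fin.last (p + 1) := by
          intro i
          have := i.is_le
          ext
          simp only [Fin.succAbove, Fin.lt_def, Fin.val_castSucc, Fin.val_last]
          split_ifs <;> (simp; try lia)
        have e3 : ∀ i : Fin (p + 1), i.castSucc.castSucc.castSucc.succAbove
            (Fin.last (p + 1)).castSucc = (Fin.last (p + 2)).castSucc := by
          intro i
          have := i.is_le
          ext
          simp only [Fin.succAbove, Fin.lt_def, Fin.val_castSucc, Fin.val_last]
          split_ifs <;> (simp; try lia)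
        have e4 : ∀ i : Fin (p + 1), i.castSucc.castSucc.castSucc.succAbove
            (Fin.last (p + 2)) = Fin.last (p + 3) := by
          intro i
          have := i.is_le
          ext
          simp only [Fin.succAbove, Fin.lt_def, Fin.val_castSucc, Fin.val_last]
          split_ifs <;> (simp; try lia)
        have f1 : ∀ k : Fin (p + 1), (Fin.last (p + 1)).castSucc.castSucc.succAbove
            k.castSucc.castSucc = k.castSucc.castSucc.castSucc := by
          intro k
          have := k.is_le
          ext
          simp only [Fin.succAbove, Fin.lt_def, Fin.val_castSucc, Fin.val_last]
          split_ifs <;> (simp; try lia)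
        have f2 : (Fin.last (p + 1)).castSucc.castSucc.succAbove (Fin.last (p + 1)).castSucc =
            (Fin.last (p + 2)).castSucc := by
          ext
          simp only [Fin.succAbove, Fin.lt_def, Fin.val_castSucc, Fin.val_last]
          split_ifs <;> (simp; try lia)
        have f3 : (Fin.last (p + 1)).castSucc.castSucc.succAbove (Fin.last (p + 2)) =
            Fin.last (p + 3) := by
          ext
          simp only [Fin.succAbove, Fin.lt_def, Fin.val_castSucc, Fin.val_last]
          split_ifs <;> (simp; try lia)
        have f4 : ∀ k : Fin (p + 1), (Fin.last (p + 2)).castSucc.succAbove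
            k.castSucc.castSucc = k.castSucc.castSucc.castSucc := by
          intro k
          have := k.is_le
          ext
          simp only [Fin.succAbove, Fin.lt_def, Fin.val_castSucc, Fin.val_last]
          split_ifs <;> (simp; try lia)
        have f5 : (Fin.last (p + 2)).castSucc.succAbove (Fin.last (p + 1)).castSucc =
            (Fin.last (p + 1)).castSucc.castSucc := by
          ext
          simp only [Fin.succAbove, Fin.lt_def, Fin.val_castSucc, Fin.val_last]
          split_ifs <;> (simp; try lia)
        have f6 : (Fin.last (p + 2)).castSucc.succAbove (Fin.last (p + 2)) =
            Fin.last (p + 3) := by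
          ext
          simp only [Fin.succAbove, Fin.lt_def, Fin.val_castSucc, Fin.val_last]
          split_ifs <;> (simp; try lia)
        simp only [e1, e2, e3, e4, f1, f2, f3, f4, f5, f6, Fin.succAbove_last]
        have hn := n.cocycle (g (Fin.last p).castSucc.castSucc.castSucc)
          (g (Fin.last (p + 1)).castSucc.castSucc) (g (Fin.last (p + 2)).castSucc)
          (g (Fin.last (p + 3)))
        simp only [Fin.val_castSucc, Fin.val_last, add_assoc]
        congr 1
        · exact Finset.sum_congr rfl fun i _ => smul_comm _ _ _
        · change _ = n.toFun (g (Fin.last (p + 1)).castSucc.castSucc)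
            (g (Fin.last (p + 2)).castSucc) (g (Fin.last (p + 3))) • _
          simp only [smul_smul, ← add_smul]
          congr 1
          linear_combination (-(-1) ^ (p + 1)) * hn
    · rw [smul_smul, smul_smul, pow_add]
      congr 1
      ring

theorem cupFamily_mem {U : Subgroup G} (n : IntCocycle U) (q r : ℤ) (hr : q + 2 = r)
    (x : Family C) (hx : x ∈ cochains C U q) : cupFamily n.toFun x ∈ cochains C U r := by
  obtain ⟨h1, h2, h3⟩ := hx
  refine ⟨fun p j h => ?_, fun p j => ?_, fun u hu => ?_⟩
  · funext g
    rcases p with _ | _ | p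
    · rfl
    · rfl
    · rw [cupFamily_succ_succ, h1 p j (by push_cast at h; lia)]
      simp
  · rcases p with _ | _ | p
    · exact IsLocallyConstant.const 0
    · exact IsLocallyConstant.const 0
    · have c1 : Continuous fun (g : Fin (p + 3) → G) (k : Fin (p + 1)) =>
          g k.castSucc.castSucc := by fun_prop
      have c2 : Continuous fun g : Fin (p + 3) → G => (g (Fin.last p).castSucc.castSucc,
          g (Fin.last (p + 1)).castSucc, g (Fin.last (p + 2))) := by fun_prop
      exact (n.isLocallyConstant.comp_continuous c2).comp₂ ((h2 p j).comp_continuous c1)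
        fun m v => m • v
  · funext p j g
    rcases p with _ | _ | p
    · simp [act_apply, cupFamily]
    · simp [act_apply, cupFamily]
    · rw [act_apply, cupFamily_succ_succ, map_zsmul, cupFamily_succ_succ]
      have := congr_fun (congr_fun (congr_fun (h3 u hu) p) j) fun k => g k.castSucc.castSucc
      rw [act_apply] at this
      rw [this]
      congr 1
      have hn := n.invariant u⁻¹ (U.inv_mem hu)
      rw [hn]

/-- The cup product `H^q(U, C) → H^(q+2)(U, C)` with the class of an integral `2`-cocycle. -/
def cup {U : Subgroup G} (n : IntCocycle U) (q r : ℤ) (hr : q + 2 = r) : H C U q →+ H C U r :=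
  mapH (cupFamily n.toFun) (dTot_cupFamily n) (cupFamily_mem n q r hr)
    (cupFamily_mem n (q - 1) (r - 1) (by lia))

end Cochains

section ClassFormation

variable {G : Type u} [Group G] [TopologicalSpace G] [IsTopologicalGroup G]

instance finite_quotient [CompactSpace G] (U V : OpenSubgroup G) :
    Finite ((U : Subgroup G) ⧸ (V : Subgroup G).subgroupOf (U : Subgroup G)) := by
  have : CompactSpace (U : Subgroup G) := isCompact_iff_compactSpace.1 U.isClosed.isCompact
  exact Subgroup.quotient_finite_of_isOpen _ (Subgroup.subgroupOf_isOpen _ _ V.isOpen)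

/-- A generalized class formation: for all open subgroups `U` of `G`, the group `H¹(U, C)`
vanishes and there is an isomorphism `inv_U : H²(U, C) ≃ ℚ/ℤ`, such that
`inv_V ∘ res = |U : V| inv_U` whenever `V ≤ U`. -/
structure GeneralizedClassFormation (C : CochainComplex (Rep.{w} ℤ G) ℤ) where
  h1 : ∀ U : OpenSubgroup G, Subsingleton (H C (U : Subgroup G) 1)
  inv : ∀ U : OpenSubgroup G, H C (U : Subgroup G) 2 ≃+ QModZ
  inv_res : ∀ (U V : OpenSubgroup G) (hVU : (V : Subgroup G) ≤ U) (c : H C (U : Subgroup G) 2),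
    inv V (res hVU 2 c) = (V : Subgroup G).relIndex U • inv U c

/-- The abelianization `U^ab` of a topological group, the quotient by the closure of the commutator
subgroup, written additively. -/
abbrev Ab (U : Subgroup G) : Type u := Additive (TopologicalAbelianization U)

/-- The projection `U → U^ab`. -/
def toAb (U : Subgroup G) : Additive U →+ Ab U :=
  MonoidHom.toAdditive (QuotientGroup.mk' (commutator U).topologicalClosure)

/-- For `V ≤ U` open and normal in `U`, the projection `U^ab → (U/V)^ab`. -/
def abProj (U V : OpenSubgroup G) [((V : Subgroup G).subgroupOf U).Normal] :
    Ab (U : Subgroup G) →+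
      Additive (Abelianization ((U : Subgroup G) ⧸ (V : Subgroup G).subgroupOf U)) :=
  MonoidHom.toAdditive <| QuotientGroup.lift _
    (Abelianization.of.comp (QuotientGroup.mk' ((V : Subgroup G).subgroupOf U))) (by
      set f := Abelianization.of.comp (QuotientGroup.mk' ((V : Subgroup G).subgroupOf U)) with hf
      have hV : (V : Subgroup G).subgroupOf U ≤ f.ker := fun v hv => by
        rw [MonoidHom.mem_ker, hf, MonoidHom.comp_apply, QuotientGroup.mk'_apply,
          (QuotientGroup.eq_one_iff v).2 hv, map_one]
      have ho : IsOpen (f.ker : Set (U : Subgroup G)) :=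
        Subgroup.isOpen_mono hV (Subgroup.subgroupOf_isOpen _ _ V.isOpen)
      exact Subgroup.topologicalClosure_minimal _ (Abelianization.commutator_subset_ker f)
        (Subgroup.isClosed_of_isOpen _ ho))

/-- `ρ` is the reciprocity map of `U`: it is characterized by the formula
`inv_U (a ∪ δ χ) = χ (ρ a)` for `a ∈ H⁰(U, C)` and all continuous characters `χ : U^ab → ℚ/ℤ`.
(A character `χ` for which `δ χ` is represented by a continuous cocycle `n` as below is
continuous, and each continuous character has such an `n`.) -/
def GeneralizedClassFormation.IsReciprocityMap {C : CochainComplex (Rep.{w} ℤ G) ℤ}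
    (F : GeneralizedClassFormation C) (U : OpenSubgroup G)
    (ρ : H C (U : Subgroup G) 0 →+ Ab (U : Subgroup G)) : Prop :=
  ∀ (χ : Ab (U : Subgroup G) →+ QModZ) (n : IntCocycle (U : Subgroup G)),
    n.RepresentsDelta (χ.comp (toAb (U : Subgroup G))) →
      ∀ a, F.inv U (cup n 0 2 rfl a) = χ (ρ a)

end ClassFormation

end Hyper

end

noncomputable section

namespace Hyper

section Operators

variable {G : Type u} [Group G] {C : CochainComplex (Rep.{w} ℤ G) ℤ}

/-- The cup product of families with a function `φ : G → ℤ`: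
`(x ∪ φ)(g₀, …, g_p) = φ(g_p) x(g₀, …, g_p)`. -/
def cupZero (φ : G → ℤ) : Family C →+ Family C where
  toFun x p j g := φ (g (Fin.last p)) • x p j g
  map_zero' := by funext p j g; simp
  map_add' x y := by funext p j g; simp

/-- The signed cup product of families with a function `m : G² → ℤ`:
`(x ∪ m)(g₀, …, g_{p+1}) = (-1)^p m(g_p, g_{p+1}) x(g₀, …, g_p)`. -/
def cupOne (m : G → G → ℤ) : Family C →+ Family C where
  toFun x
    | 0, _, _ => 0
    | p + 1, j, g => ((-1 : ℤ) ^ p * m (g (Fin.last p).castSucc) (g (Fin.last (p + 1)))) •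
        x p j fun k => g k.castSucc
  map_zero' := by funext p j g; cases p <;> simp
  map_add' x y := by funext p j g; cases p <;> simp

theorem cupZero_apply (φ : G → ℤ) (x : Family C) (p : ℕ) (j : ℤ) (g : Fin (p + 1) → G) :
    cupZero φ x p j g = φ (g (Fin.last p)) • x p j g := rfl

theorem cupOne_zero (m : G → G → ℤ) (x : Family C) (j : ℤ) (g : Fin 1 → G) :
    cupOne m x 0 j g = 0 := rfl

theorem cupOne_succ (m : G → G → ℤ) (x : Family C) (p : ℕ) (j : ℤ) (g : Fin (p + 2) → G) :
    cupOne m x (p + 1) j g =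
      ((-1 : ℤ) ^ p * m (g (Fin.last p).castSucc) (g (Fin.last (p + 1)))) •
        x p j fun k => g k.castSucc := rfl

theorem act_cupZero (u : G) (φ : G → ℤ) (x : Family C) :
    act u (cupZero φ x) = cupZero (fun a => φ (u⁻¹ * a)) (act u x) := by
  funext p j g
  simp [act_apply, cupZero_apply]

theorem act_cupOne (u : G) (m : G → G → ℤ) (x : Family C) :
    act u (cupOne m x) = cupOne (fun a b => m (u⁻¹ * a) (u⁻¹ * b)) (act u x) := by
  funext p j g
  rcases p with _ | p
  · simp [act_apply, cupOne_zero]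
  · simp only [act_apply, cupOne_succ, map_zsmul]

theorem act_cupFamily (u : G) (n : G → G → G → ℤ) (x : Family C) :
    act u (cupFamily n x) =
      cupFamily (fun a b c => n (u⁻¹ * a) (u⁻¹ * b) (u⁻¹ * c)) (act u x) := by
  funext p j g
  rcases p with _ | _ | p
  · simp [act_apply, cupFamily]
  · simp [act_apply, cupFamily]
  · simp only [act_apply, cupFamily_succ_succ, map_zsmul]

theorem cupZero_sum {ι : Type*} (s : Finset ι) (φ : ι → G → ℤ) (x : Family C) :
    cupZero (fun a => ∑ i ∈ s, φ i a) x = ∑ i ∈ s, cupZero (φ i) x := by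
  funext p j g
  simp [cupZero_apply, Finset.sum_apply, Finset.sum_smul]

theorem cupZero_one (x : Family C) : cupZero (fun _ => 1) x = x := by
  funext p j g
  simp [cupZero_apply]

theorem cupOne_sub (m m' : G → G → ℤ) (x : Family C) :
    cupOne (fun a b => m a b - m' a b) x = cupOne m x - cupOne m' x := by
  funext p j g
  rcases p with _ | p
  · simp [cupOne_zero]
  · simp [cupOne_succ, mul_sub, sub_smul]

theorem cupFamily_add (n n' : G → G → G → ℤ) (x : Family C) :
    cupFamily (fun a b c => n a b c + n' a b c) x = cupFamily n x + cupFamily n' x := by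
  funext p j g
  rcases p with _ | _ | p
  · simp [cupFamily]
  · simp [cupFamily]
  · simp [cupFamily_succ_succ, add_smul]

theorem cupFamily_sub (n n' : G → G → G → ℤ) (x : Family C) :
    cupFamily (fun a b c => n a b c - n' a b c) x = cupFamily n x - cupFamily n' x := by
  rw [eq_sub_iff_add_eq, ← cupFamily_add]
  simp

theorem cupFamily_sum {ι : Type*} (s : Finset ι) (n : ι → G → G → G → ℤ) (x : Family C) :
    cupFamily (fun a b c => ∑ i ∈ s, n i a b c) x = ∑ i ∈ s, cupFamily (n i) x := by
  funext p j g
  rcases p with _ | _ | p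
  · simp [cupFamily, Finset.sum_apply]
  · simp [cupFamily, Finset.sum_apply]
  · simp [cupFamily_succ_succ, Finset.sum_apply, Finset.sum_smul]

theorem castSucc_succAbove_last {p : ℕ} (i : Fin (p + 1)) :
    i.castSucc.succAbove (Fin.last p) = Fin.last (p + 1) := by
  rw [Fin.succAbove_of_le_castSucc _ _ (Fin.castSucc_le_castSucc_iff.2 i.le_last), Fin.succ_last]

theorem dTot_cupZero (φ : G → ℤ) (x : Family C) :
    dTot (cupZero φ x) = cupZero φ (dTot x) + cupOne (fun a b => φ b - φ a) x := by
  funext p j g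
  rcases p with _ | p
  · simp [dTot_apply, dGroup_zero, dComplex_apply, cupZero_apply, cupOne_zero]
  · simp only [Pi.add_apply, dTot_apply, dGroup_succ, dComplex_apply, cupZero_apply, cupOne_succ,
      map_zsmul, smul_add]
    rw [Fin.sum_univ_castSucc (n := p + 1), Fin.sum_univ_castSucc (n := p + 1)]
    simp only [castSucc_succAbove_last, Fin.succAbove_last, smul_add, Finset.smul_sum,
      Fin.val_castSucc, Fin.val_last, smul_comm (φ _), smul_smul]
    have h1 : (-1 : ℤ) ^ p * (φ (g (Fin.last (p + 1))) - φ (g (Fin.last p).castSucc)) =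
        (-1) ^ (p + 1) * φ (g (Fin.last p).castSucc) -
          (-1) ^ (p + 1) * φ (g (Fin.last (p + 1))) := by ring
    rw [h1, sub_smul]
    abel

theorem dTot_cupOne (m : G → G → ℤ) (x : Family C) :
    dTot (cupOne m x) =
      cupFamily (fun a b c => m b c - m a c + m a b) x - cupOne m (dTot x) := by
  funext p j g
  rw [Pi.sub_apply, Pi.sub_apply, Pi.sub_apply]
  rcases p with _ | _ | p
  · simp [dTot_apply, dGroup_zero, dComplex_apply, cupOne_zero, cupFamily]
  · simp [dTot_apply, dGroup_succ, dGroup_zero, dComplex_apply, cupOne_zero, cupOne_succ,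
      cupFamily]
  · simp only [dTot_apply, dGroup_succ, dComplex_apply, cupFamily_succ_succ, cupOne_succ,
      map_zsmul, smul_add]
    rw [Fin.sum_univ_castSucc, Fin.sum_univ_castSucc, Fin.sum_univ_castSucc (n := p + 1)]
    have f1 : ∀ i : Fin (p + 1), i.castSucc.castSucc.succAbove (Fin.last p).castSucc =
        (Fin.last (p + 1)).castSucc := fun i => by
      rw [Fin.castSucc_succAbove_castSucc, castSucc_succAbove_last]
    have f3 : (Fin.last (p + 1)).castSucc.succAbove (Fin.last p).castSucc =
        (Fin.last p).castSucc.castSucc := by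
      rw [Fin.castSucc_succAbove_castSucc, Fin.succAbove_last]
    simp only [f1, f3, castSucc_succAbove_last, Fin.succAbove_last,
      Fin.castSucc_succAbove_castSucc, Fin.val_castSucc, Fin.val_last, smul_add, Finset.smul_sum,
      smul_smul]
    have hs : ∀ i : Fin (p + 1), (-1 : ℤ) ^ (i : ℕ) * ((-1) ^ p *
        m (g (Fin.last (p + 1)).castSucc) (g (Fin.last (p + 2)))) =
        -((-1) ^ (p + 1) * m (g (Fin.last (p + 1)).castSucc) (g (Fin.last (p + 2))) *
          (-1) ^ (i : ℕ)) := fun i => by ring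
    simp only [hs, neg_smul, Finset.sum_neg_distrib]
    have h2 : (-1 : ℤ) ^ (p + 2) * ((-1) ^ (p + 1) *
        m (g (Fin.last (p + 1)).castSucc) (g (Fin.last (p + 2)))) =
        -((-1) ^ (p + 1) * m (g (Fin.last (p + 1)).castSucc) (g (Fin.last (p + 2))) *
          (-1) ^ (p + 1)) := by ring
    have hp : (-1 : ℤ) ^ p * (-1) ^ p = 1 := by rw [← mul_pow]; simp
    have c1 : (-1 : ℤ) ^ (p + 1) * ((-1) ^ p * m (g (Fin.last p).castSucc.castSucc)
        (g (Fin.last (p + 2)))) =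
        -m (g (Fin.last p).castSucc.castSucc) (g (Fin.last (p + 2))) := by
      linear_combination (-m (g (Fin.last p).castSucc.castSucc) (g (Fin.last (p + 2)))) * hp
    have c2 : (-1 : ℤ) ^ (p + 1 + 1) * ((-1) ^ p * m (g (Fin.last p).castSucc.castSucc)
        (g (Fin.last (p + 1)).castSucc)) =
        m (g (Fin.last p).castSucc.castSucc) (g (Fin.last (p + 1)).castSucc) := by
      linear_combination (m (g (Fin.last p).castSucc.castSucc)
        (g (Fin.last (p + 1)).castSucc)) * hp
    have c3 : (-1 : ℤ) ^ (p + 1) * m (g (Fin.last (p + 1)).castSucc) (g (Fin.last (p + 2))) *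
        (-1) ^ (p + 1) = m (g (Fin.last (p + 1)).castSucc) (g (Fin.last (p + 2))) := by
      linear_combination (m (g (Fin.last (p + 1)).castSucc) (g (Fin.last (p + 2)))) * hp
    rw [h2, c1, c2, c3, neg_smul, neg_smul]
    simp only [sub_smul, add_smul]
    abel

end Operators

section Membership

variable {G : Type u} [Group G] [TopologicalSpace G] {C : CochainComplex (Rep.{w} ℤ G) ℤ}
  {U : Subgroup G}

theorem cupZero_mem {φ : G → ℤ} (hφ : IsLocallyConstant φ) (hU : ∀ u ∈ U, ∀ a, φ (u * a) = φ a)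
    {q : ℤ} {x : Family C} (hx : x ∈ cochains C U q) : cupZero φ x ∈ cochains C U q := by
  refine ⟨fun p j h => ?_, fun p j => ?_, fun u hu => ?_⟩
  · funext g
    simp [cupZero_apply, hx.1 p j h]
  · exact (hφ.comp_continuous (continuous_apply (Fin.last p))).comp₂ (hx.2.1 p j)
      fun m v => m • v
  · rw [act_cupZero, hx.2.2 u hu]
    simp only [hU _ (U.inv_mem hu)]

theorem cupOne_mem {m : G → G → ℤ} (hm : IsLocallyConstant fun g : G × G => m g.1 g.2)
    (hU : ∀ u ∈ U, ∀ a b, m (u * a) (u * b) = m a b)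
    {q r : ℤ} (hr : q + 1 = r) {x : Family C} (hx : x ∈ cochains C U q) :
    cupOne m x ∈ cochains C U r := by
  refine ⟨fun p j h => ?_, fun p j => ?_, fun u hu => ?_⟩
  · funext g
    rcases p with _ | p
    · rfl
    · rw [cupOne_succ, hx.1 p j (by push_cast at h; lia)]
      simp
  · rcases p with _ | p
    · exact IsLocallyConstant.const 0
    · have c1 : Continuous fun (g : Fin (p + 2) → G) (k : Fin (p + 1)) => g k.castSucc := by
        fun_prop
      have c2 : Continuous fun g : Fin (p + 2) → G =>
          (g (Fin.last p).castSucc, g (Fin.last (p + 1))) := by fun_prop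
      exact (hm.comp_continuous c2).comp₂ ((hx.2.1 p j).comp_continuous c1)
        fun m v => ((-1 : ℤ) ^ p * m) • v
  · rw [act_cupOne, hx.2.2 u hu]
    simp only [hU _ (U.inv_mem hu)]

theorem cochains_mono {V : Subgroup G} (h : V ≤ U) (q : ℤ) : cochains C U q ≤ cochains C V q :=
  fun _ hx => ⟨hx.1, hx.2.1, fun v hv => hx.2.2 v (h hv)⟩

theorem dTot_mem {q r : ℤ} (hr : q + 1 = r) {x : Family C} (hx : x ∈ cochains C U q) :
    dTot x ∈ cochains C U r :=
  (coboundaries_le_cocycles U r ⟨x, by rwa [← hr, add_sub_cancel_right], rfl⟩).1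

theorem act_mem [ContinuousMul G] {V : Subgroup G} [(V.subgroupOf U).Normal] {u : G} (hu : u ∈ U)
    (hVU : V ≤ U) {q : ℤ} {x : Family C} (hx : x ∈ cochains C V q) : act u x ∈ cochains C V q := by
  refine ⟨fun p j h => ?_, fun p j => act_mem_locallyConstant u hx.2.1 p j, fun v hv => ?_⟩
  · funext g
    simp [act_apply, hx.1 p j h]
  · have h := (inferInstance : (V.subgroupOf U).Normal).conj_mem ⟨v, hVU hv⟩
      (Subgroup.mem_subgroupOf.2 hv) ⟨u⁻¹, U.inv_mem hu⟩
    have h' : u⁻¹ * v * u ∈ V := by simpa [Subgroup.mem_subgroupOf] using h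
    rw [← act_mul, show v * u = u * (u⁻¹ * v * u) by group, act_mul, hx.2.2 _ h']

end Membership

section Classes

variable {G : Type u} [Group G] [TopologicalSpace G] {C : CochainComplex (Rep.{w} ℤ G) ℤ}
  {U V : Subgroup G} {q : ℤ}

/-- The hypercohomology class of a cocycle. -/
def classOf (x : Family C) (hx : x ∈ cocycles C U q) : H C U q :=
  QuotientAddGroup.mk ⟨x, hx⟩

theorem exists_classOf (c : H C U q) : ∃ (x : Family C) (hx : x ∈ cocycles C U q),
    classOf x hx = c := by
  obtain ⟨⟨x, hx⟩, rfl⟩ := QuotientAddGroup.mk_surjective c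
  exact ⟨x, hx, rfl⟩

theorem classOf_add {x y : Family C} (hx : x ∈ cocycles C U q) (hy : y ∈ cocycles C U q) :
    classOf (x + y) (add_mem hx hy) = classOf x hx + classOf y hy := rfl

theorem classOf_sub {x y : Family C} (hx : x ∈ cocycles C U q) (hy : y ∈ cocycles C U q) :
    classOf (x - y) (sub_mem hx hy) = classOf x hx - classOf y hy := rfl

theorem classOf_nsmul {x : Family C} (n : ℕ) (hx : x ∈ cocycles C U q) :
    classOf (n • x) (nsmul_mem hx n) = n • classOf x hx := rfl

theorem classOf_congr {x y : Family C} (h : x = y) (hx : x ∈ cocycles C U q) :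
    classOf x hx = classOf y (h ▸ hx) := by
  subst h
  rfl

theorem classOf_eq_zero {r : ℤ} (hr : r + 1 = q) {x : Family C} (hx : x ∈ cocycles C U q) :
    classOf x hx = 0 ↔ ∃ y ∈ cochains C U r, dTot y = x := by
  obtain rfl : r = q - 1 := by lia
  rw [classOf, QuotientAddGroup.eq_zero_iff, AddSubgroup.mem_addSubgroupOf]
  rfl

theorem classOf_eq {r : ℤ} (hr : r + 1 = q) {x y : Family C} (hx : x ∈ cocycles C U q)
    (hy : y ∈ cocycles C U q) :
    classOf x hx = classOf y hy ↔ ∃ z ∈ cochains C U r, dTot z = x - y := by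
  rw [← sub_eq_zero, ← classOf_sub, classOf_eq_zero hr]

theorem mem_cocycles {x : Family C} : x ∈ cocycles C U q ↔ x ∈ cochains C U q ∧ dTot x = 0 :=
  Iff.rfl

theorem cocycles_mono (h : V ≤ U) : cocycles C U q ≤ cocycles C V q :=
  fun _ hx => ⟨cochains_mono h q hx.1, hx.2⟩

theorem res_classOf (h : V ≤ U) {x : Family C} (hx : x ∈ cocycles C U q) :
    res h q (classOf x hx) = classOf x (cocycles_mono h hx) := rfl

theorem cup_mem {r : ℤ} (n : IntCocycle U) (hr : q + 2 = r) {x : Family C}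
    (hx : x ∈ cocycles C U q) : cupFamily n.toFun x ∈ cocycles C U r := by
  refine ⟨cupFamily_mem n q r hr x hx.1, ?_⟩
  change dTot _ = 0
  rw [dTot_cupFamily, hx.2, map_zero]

theorem cup_classOf {r : ℤ} (n : IntCocycle U) (hr : q + 2 = r) {x : Family C}
    (hx : x ∈ cocycles C U q) :
    cup n q r hr (classOf x hx) = classOf (cupFamily n.toFun x) (cup_mem n hr hx) := rfl

section

variable [ContinuousMul G]

theorem norm_mem_cocycles [Fintype (U ⧸ V.subgroupOf U)] {x : Family C}
    (hx : x ∈ cocycles C V q) : norm U V x ∈ cocycles C U q := by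
  refine ⟨norm_mem U V q x hx.1, ?_⟩
  change dTot _ = 0
  rw [dTot_norm, hx.2, map_zero]

theorem cor_classOf [Finite (U ⧸ V.subgroupOf U)] [h : Fintype (U ⧸ V.subgroupOf U)]
    (hVU : V ≤ U) {x : Family C}
    (hx : x ∈ cocycles C V q) :
    cor hVU q (classOf x hx) = classOf (norm U V x) (norm_mem_cocycles hx) := by
  obtain rfl : h = Fintype.ofFinite (U ⧸ V.subgroupOf U) := Subsingleton.elim _ _
  rfl

theorem act_mem_cocycles [(V.subgroupOf U).Normal] {u : G} (hu : u ∈ U) (hVU : V ≤ U)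
    {x : Family C} (hx : x ∈ cocycles C V q) : act u x ∈ cocycles C V q := by
  refine ⟨act_mem hu hVU hx.1, ?_⟩
  change dTot _ = 0
  rw [← act_dTot, hx.2, map_zero]

/-- The action of `u ∈ U` on the hypercohomology of a normal subgroup `V` of `U`. -/
def conj [(V.subgroupOf U).Normal] (hVU : V ≤ U) (q : ℤ) (u : U) : H C V q →+ H C V q :=
  mapH (act (u : G)) (fun x => (act_dTot _ x).symm) (fun _ => act_mem u.2 hVU)
    (fun _ => act_mem u.2 hVU)

theorem conj_classOf [(V.subgroupOf U).Normal] (hVU : V ≤ U) (u : U) {x : Family C}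
    (hx : x ∈ cocycles C V q) :
    conj hVU q u (classOf x hx) = classOf (act (u : G) x) (act_mem_cocycles u.2 hVU hx) := rfl

end

end Classes

section Norm

variable {G : Type u} [Group G] {C : CochainComplex (Rep.{w} ℤ G) ℤ} {U V : Subgroup G}

theorem norm_eq_sum [Fintype (U ⧸ V.subgroupOf U)] {ι : Type*} [Fintype ι] (t : ι → U)
    (ht : Function.Bijective fun i => (t i : U ⧸ V.subgroupOf U)) {x : Family C}
    (hx : ∀ v ∈ V, act v x = x) : norm U V x = ∑ i, act (t i : G) x := by
  rw [norm_apply]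
  refine (Fintype.sum_equiv (Equiv.ofBijective _ ht) _ _ fun i => ?_).symm
  refine act_eq_of_mk_eq hx ?_
  simp

theorem norm_of_invariant [Fintype (U ⧸ V.subgroupOf U)] {x : Family C}
    (hx : ∀ u ∈ U, act u x = x) : norm U V x = V.relIndex U • x := by
  rw [norm_apply, Finset.sum_congr rfl fun (s : U ⧸ V.subgroupOf U) _ => hx _ s.out.2,
    Finset.sum_const, Finset.card_univ, Subgroup.relIndex, Subgroup.index,
    Nat.card_eq_fintype_card]

theorem norm_act [Fintype (U ⧸ V.subgroupOf U)] [(V.subgroupOf U).Normal] (u : U) {x : Family C}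
    (hx : ∀ v ∈ V, act v x = x) : norm U V (act (u : G) x) = norm U V x := by
  rw [norm_eq_sum (fun s : U ⧸ V.subgroupOf U => s.out * u) _ hx, norm_apply]
  · simp [act_mul]
  · convert (Equiv.mulRight (u : U ⧸ V.subgroupOf U)).bijective using 2 with s
    simp

theorem norm_eq_sum_inv [Fintype (U ⧸ V.subgroupOf U)] [(V.subgroupOf U).Normal] {x : Family C}
    (hx : ∀ v ∈ V, act v x = x) :
    norm U V x = ∑ s : U ⧸ V.subgroupOf U, act (s.out : G)⁻¹ x := by
  rw [norm_eq_sum (fun s : U ⧸ V.subgroupOf U => s.out⁻¹) _ hx]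
  · simp
  · convert (Equiv.inv (U ⧸ V.subgroupOf U)).bijective using 2 with s
    simp

theorem norm_norm {W : Subgroup G} (hWU : W ≤ U) (hVW : V ≤ W) [Fintype (U ⧸ W.subgroupOf U)]
    [Fintype (W ⧸ V.subgroupOf W)] [Fintype (U ⧸ V.subgroupOf U)] {x : Family C}
    (hx : ∀ v ∈ V, act v x = x) : norm U W (norm W V x) = norm U V x := by
  let t (i : (U ⧸ W.subgroupOf U) × (W ⧸ V.subgroupOf W)) : U :=
    i.1.out * ⟨(i.2.out : G), hWU i.2.out.2⟩
  rw [norm_eq_sum t _ hx, Fintype.sum_prod_type, norm_apply, norm_apply]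
  · simp only [map_sum]
    refine Finset.sum_congr rfl fun s _ => Finset.sum_congr rfl fun r _ => ?_
    rw [← act_mul]
    rfl
  · constructor
    · rintro ⟨s, r⟩ ⟨s', r'⟩ h
      have h1 : ((s.out * ⟨(r.out : G), hWU r.out.2⟩)⁻¹ *
          (s'.out * ⟨(r'.out : G), hWU r'.out.2⟩) : U) ∈ V.subgroupOf U := QuotientGroup.eq.1 h
      rw [Subgroup.mem_subgroupOf] at h1
      have hs : s = s' := by
        rw [← QuotientGroup.out_eq' s, ← QuotientGroup.out_eq' s']
        refine QuotientGroup.eq.2 (Subgroup.mem_subgroupOf.2 ?_)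
        have := W.mul_mem (W.mul_mem r.out.2 (hVW h1)) (W.inv_mem r'.out.2)
        convert this using 1
        simp [mul_assoc]
      subst hs
      congr 1
      rw [← QuotientGroup.out_eq' r, ← QuotientGroup.out_eq' r']
      refine QuotientGroup.eq.2 (Subgroup.mem_subgroupOf.2 ?_)
      convert h1 using 1
      simp [mul_assoc]
    · intro c
      obtain ⟨u, rfl⟩ := QuotientGroup.mk_surjective c
      have hw : ((u : U ⧸ W.subgroupOf U).out : G)⁻¹ * u ∈ W := by
        have := QuotientGroup.eq.1 (QuotientGroup.out_eq' (u : U ⧸ W.subgroupOf U))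
        simpa [Subgroup.mem_subgroupOf] using this
      refine ⟨(u, (⟨_, hw⟩ : W)), QuotientGroup.eq.2 (Subgroup.mem_subgroupOf.2 ?_)⟩
      have := QuotientGroup.eq.1 (QuotientGroup.out_eq' ((⟨_, hw⟩ : W) : W ⧸ V.subgroupOf W))
      rw [Subgroup.mem_subgroupOf] at this
      convert this using 1
      simp [t, mul_assoc]

end Norm

section Cor

variable {G : Type u} [Group G] [TopologicalSpace G] [ContinuousMul G]
  {C : CochainComplex (Rep.{w} ℤ G) ℤ} {U V : Subgroup G}

theorem cor_res [Finite (U ⧸ V.subgroupOf U)] (hVU : V ≤ U) {q : ℤ} (c : H C U q) :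
    cor hVU q (res hVU q c) = V.relIndex U • c := by
  have := Fintype.ofFinite (U ⧸ V.subgroupOf U)
  obtain ⟨x, hx, rfl⟩ := exists_classOf c
  rw [res_classOf, cor_classOf, ← classOf_nsmul]
  exact classOf_congr (norm_of_invariant hx.1.2.2) _

theorem cor_conj [Finite (U ⧸ V.subgroupOf U)] [(V.subgroupOf U).Normal] (hVU : V ≤ U) {q : ℤ}
    (u : U) (c : H C V q) : cor hVU q (conj hVU q u c) = cor hVU q c := by
  have := Fintype.ofFinite (U ⧸ V.subgroupOf U)
  obtain ⟨x, hx, rfl⟩ := exists_classOf c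
  rw [conj_classOf, cor_classOf, cor_classOf]
  exact classOf_congr (norm_act u hx.1.2.2) _

theorem cor_cor {W : Subgroup G} (hWU : W ≤ U) (hVW : V ≤ W) [Finite (U ⧸ W.subgroupOf U)]
    [Finite (W ⧸ V.subgroupOf W)] [Finite (U ⧸ V.subgroupOf U)] {q : ℤ} (c : H C V q) :
    cor hWU q (cor hVW q c) = cor (hVW.trans hWU) q c := by
  have := Fintype.ofFinite (U ⧸ V.subgroupOf U)
  have := Fintype.ofFinite (W ⧸ V.subgroupOf W)
  have := Fintype.ofFinite (U ⧸ W.subgroupOf U)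
  obtain ⟨x, hx, rfl⟩ := exists_classOf c
  rw [cor_classOf, cor_classOf, cor_classOf]
  exact classOf_congr (norm_norm hWU hVW hx.1.2.2) _

theorem cor_self [Finite (U ⧸ U.subgroupOf U)] {q : ℤ} (c : H C U q) :
    cor le_rfl q c = c := by
  obtain ⟨x, hx, rfl⟩ := exists_classOf c
  refine (cor_res le_rfl (classOf x hx)).trans ?_
  rw [Subgroup.relIndex_self, one_nsmul]

end Cor

section Invariants

variable {G : Type u} [Group G] [TopologicalSpace G] [IsTopologicalGroup G] [CompactSpace G]
  {C : CochainComplex (Rep.{w} ℤ G) ℤ} (F : GeneralizedClassFormation C)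

theorem exists_nsmul_eq {n : ℕ} (hn : n ≠ 0) (t : QModZ) : ∃ s : QModZ, n • s = t := by
  obtain ⟨a, rfl⟩ := QuotientAddGroup.mk_surjective t
  refine ⟨((a / n : ℚ) : QModZ), ?_⟩
  rw [← AddCircle.coe_nsmul, nsmul_eq_mul, mul_div_cancel₀ _ (Nat.cast_ne_zero.2 hn)]

theorem relIndex_ne_zero (U V : OpenSubgroup G) : (V : Subgroup G).relIndex U ≠ 0 :=
  Subgroup.index_ne_zero_of_finite

namespace GeneralizedClassFormation

theorem inv_cor {U V : OpenSubgroup G} (hVU : (V : Subgroup G) ≤ U)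
    (c : H C (V : Subgroup G) 2) : F.inv U (cor hVU 2 c) = F.inv V c := by
  obtain ⟨t, ht⟩ := exists_nsmul_eq (relIndex_ne_zero U V) (F.inv V c)
  obtain ⟨d, rfl⟩ := (F.inv U).surjective t
  rw [← F.inv_res U V hVU] at ht
  rw [← (F.inv V).injective ht, cor_res, map_nsmul, F.inv_res U V hVU]

theorem inv_conj {U V : OpenSubgroup G} (hVU : (V : Subgroup G) ≤ U)
    [((V : Subgroup G).subgroupOf U).Normal] (u : U) (c : H C (V : Subgroup G) 2) :
    F.inv V (conj hVU 2 u c) = F.inv V c := by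
  rw [← F.inv_cor hVU, ← F.inv_cor hVU c]
  exact congrArg _ (cor_conj hVU u c)

end GeneralizedClassFormation

end Invariants

/-- The representative of an element of `ℚ/ℤ` in the interval `[0, 1)`. -/
def QModZ.lift (t : QModZ) : ℚ := AddCircle.equivIco (1 : ℚ) 0 t

theorem QModZ.coe_lift (t : QModZ) : (QModZ.lift t : QModZ) = t :=
  (AddCircle.equivIco (1 : ℚ) 0).symm_apply_apply t

theorem QModZ.lift_mem (t : QModZ) : QModZ.lift t ∈ Set.Ico (0 : ℚ) 1 := by
  have h := (AddCircle.equivIco (1 : ℚ) 0 t).2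
  exact ⟨h.1, h.2.trans_eq (zero_add 1)⟩

theorem QModZ.lift_coe {a : ℚ} (h : a ∈ Set.Ico (0 : ℚ) 1) : QModZ.lift (a : QModZ) = a :=
  congrArg Subtype.val
    ((AddCircle.equivIco (1 : ℚ) 0).apply_symm_apply
      (⟨a, by rwa [zero_add]⟩ : Set.Ico (0 : ℚ) (0 + 1)))

theorem QModZ.coe_int (z : ℤ) : ((z : ℚ) : QModZ) = 0 :=
  (AddCircle.coe_eq_zero_iff (1 : ℚ)).2 ⟨z, by simp⟩

theorem QModZ.floor_eq {a : ℚ} (h : (a : QModZ) = 0) : ((⌊a⌋ : ℤ) : ℚ) = a := by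
  obtain ⟨z, rfl⟩ := (AddCircle.coe_eq_zero_iff (1 : ℚ)).1 h
  simp

section LocallyConstant

variable {G X : Type*} [Group G] [TopologicalSpace G] [IsTopologicalGroup G]

theorem isLocallyConstant_of_mul_left {f : G → X} {N : Set G} (hN : IsOpen N) (h1 : 1 ∈ N)
    (h : ∀ w ∈ N, ∀ g, f (w * g) = f g) : IsLocallyConstant f := by
  refine (IsLocallyConstant.iff_eventually_eq f).2 fun x => ?_
  have hc : Continuous fun y : G => y * x⁻¹ := by fun_prop
  filter_upwards [(hN.preimage hc).mem_nhds (by simpa using h1)] with y hy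
  simpa using h _ hy x

end LocallyConstant

section AbstractCharacters

theorem coe_coboundary_eq_zero {G : Type*} {f : G → G → ℚ} {n : G → G → G → ℤ}
    (h : ∀ a b c : G, f b c - f a c + f a b = n a b c) (a b c : G) :
    ((f b c - f a c + f a b : ℚ) : QModZ) = 0 := by
  rw [h, QModZ.coe_int]

theorem coe_eq_sub {G : Type*} {f : G → G → ℚ}
    (h : ∀ a b c, ((f b c - f a c + f a b : ℚ) : QModZ) = 0)
    (c a b : G) : (f a b : QModZ) = f c b - f c a := by
  have := h c a b
  simp only [AddCircle.coe_sub, AddCircle.coe_add] at this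
  rwa [sub_add, sub_eq_zero] at this

variable {G : Type*} [Group G] {U : Subgroup G}

/-- The restriction of characters to a subgroup. -/
def resChar {V : Subgroup G} (h : V ≤ U) (χ : Additive U →+ QModZ) : Additive V →+ QModZ :=
  χ.comp (MonoidHom.toAdditive (Subgroup.inclusion h))

theorem coe_mul_eq_add {f : G → G → ℚ} (hU : ∀ u ∈ U, ∀ a b, f (u * a) (u * b) = f a b)
    (h : ∀ a b c, ((f b c - f a c + f a b : ℚ) : QModZ) = 0) {u : G} (hu : u ∈ U) (a : G) :
    (f 1 (u * a) : QModZ) = f 1 u + f 1 a := by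
  have h1 : (f u (u * a) : QModZ) = f 1 a := by
    have := hU u hu 1 a
    rw [mul_one] at this
    rw [this]
  rw [← h1, coe_eq_sub h 1 u (u * a)]
  abel

/-- The character given by the reduction modulo `ℤ` of a rational cochain. -/
def charOfFun (f : G → G → ℚ) (hU : ∀ u ∈ U, ∀ a b, f (u * a) (u * b) = f a b)
    (hd : ∀ a b c, ((f b c - f a c + f a b : ℚ) : QModZ) = 0) : Additive U →+ QModZ :=
  AddMonoidHom.mk' (fun u => ((f 1 (u.toMul : U) : ℚ) : QModZ))
    fun a _ => coe_mul_eq_add hU hd a.toMul.2 _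

end AbstractCharacters

section Characters

variable {G : Type u} [Group G] [TopologicalSpace G]

/-- The continuous characters `U → ℚ/ℤ`. -/
def contChars (U : Subgroup G) : AddSubgroup (Additive U →+ QModZ) where
  carrier := {χ | IsLocallyConstant fun u : U => χ (Additive.ofMul u)}
  zero_mem' := IsLocallyConstant.const 0
  add_mem' h h' := IsLocallyConstant.add h h'
  neg_mem' h := IsLocallyConstant.neg h

theorem resChar_mem {U V : Subgroup G} (h : V ≤ U) {χ : Additive U →+ QModZ}
    (hχ : χ ∈ contChars U) : resChar h χ ∈ contChars V := by
  have hc : Continuous (Subgroup.inclusion h) := continuous_inclusion h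
  have hχ' : IsLocallyConstant fun u : U => χ (Additive.ofMul u) := hχ
  exact hχ'.comp_continuous hc

variable {U : Subgroup G}

/-- The integral `2`-cocycle that is the coboundary of a rational cochain. -/
def IntCocycle.ofFun (f : G → G → ℚ) (hf : IsLocallyConstant fun g : G × G => f g.1 g.2)
    (hU : ∀ u ∈ U, ∀ a b, f (u * a) (u * b) = f a b)
    (hd : ∀ a b c, ((f b c - f a c + f a b : ℚ) : QModZ) = 0) : IntCocycle U where
  toFun a b c := ⌊f b c - f a c + f a b⌋
  isLocallyConstant := by
    have h1 : IsLocallyConstant fun g : G × G × G => f g.2.1 g.2.2 :=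
      hf.comp_continuous (f := fun g : G × G × G => (g.2.1, g.2.2)) (by fun_prop)
    have h2 : IsLocallyConstant fun g : G × G × G => f g.1 g.2.2 :=
      hf.comp_continuous (f := fun g : G × G × G => (g.1, g.2.2)) (by fun_prop)
    have h3 : IsLocallyConstant fun g : G × G × G => f g.1 g.2.1 :=
      hf.comp_continuous (f := fun g : G × G × G => (g.1, g.2.1)) (by fun_prop)
    exact ((h1.sub h2).add h3).comp Int.floor
  invariant u hu a b c := by rw [hU u hu, hU u hu, hU u hu]
  cocycle a b c d := by
    have h : ((⌊f c d - f b d + f b c⌋ - ⌊f c d - f a d + f a c⌋ + ⌊f b d - f a d + f a b⌋ -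
        ⌊f b c - f a c + f a b⌋ : ℤ) : ℚ) = 0 := by
      push_cast
      rw [QModZ.floor_eq (hd _ _ _), QModZ.floor_eq (hd _ _ _), QModZ.floor_eq (hd _ _ _),
        QModZ.floor_eq (hd _ _ _)]
      ring
    exact_mod_cast h

theorem IntCocycle.ofFun_apply (f : G → G → ℚ) (hf : IsLocallyConstant fun g : G × G => f g.1 g.2)
    (hU : ∀ u ∈ U, ∀ a b, f (u * a) (u * b) = f a b)
    (hd : ∀ a b c, ((f b c - f a c + f a b : ℚ) : QModZ) = 0) (a b c : G) :
    ((IntCocycle.ofFun f hf hU hd).toFun a b c : ℚ) = f b c - f a c + f a b :=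
  QModZ.floor_eq (hd a b c)

theorem IntCocycle.ofFun_representsDelta (f : G → G → ℚ)
    (hf : IsLocallyConstant fun g : G × G => f g.1 g.2)
    (hU : ∀ u ∈ U, ∀ a b, f (u * a) (u * b) = f a b)
    (hd : ∀ a b c, ((f b c - f a c + f a b : ℚ) : QModZ) = 0) {χ : Additive U →+ QModZ}
    (hχ : ∀ u : U, ((f 1 u : ℚ) : QModZ) = χ (Additive.ofMul u)) :
    (IntCocycle.ofFun f hf hU hd).RepresentsDelta χ :=
  ⟨f, hf, hU, hχ, fun a b c => (IntCocycle.ofFun_apply f hf hU hd a b c).symm⟩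

theorem IntCocycle.RepresentsDelta.mem_contChars {n : IntCocycle U} {χ : Additive U →+ QModZ}
    (h : n.RepresentsDelta χ) : χ ∈ contChars U := by
  obtain ⟨f, hf, -, hχ, -⟩ := h
  have h1 : IsLocallyConstant fun u : U => f 1 u :=
    hf.comp_continuous (f := fun u : U => ((1 : G), (u : G))) (by fun_prop)
  have h2 := h1.comp fun t : ℚ => (t : QModZ)
  have h3 : ((fun t : ℚ => (t : QModZ)) ∘ fun u : U => f 1 u) =
    fun u : U => χ (Additive.ofMul u) := funext hχ
  rwa [h3] at h2

/-- The sum of integral cocycles. -/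
def IntCocycle.add (n n' : IntCocycle U) : IntCocycle U where
  toFun a b c := n.toFun a b c + n'.toFun a b c
  isLocallyConstant := n.isLocallyConstant.add n'.isLocallyConstant
  invariant u hu a b c := by rw [n.invariant u hu, n'.invariant u hu]
  cocycle a b c d := by linear_combination n.cocycle a b c d + n'.cocycle a b c d

theorem IntCocycle.RepresentsDelta.add {n n' : IntCocycle U} {χ χ' : Additive U →+ QModZ}
    (h : n.RepresentsDelta χ) (h' : n'.RepresentsDelta χ') :
    (n.add n').RepresentsDelta (χ + χ') := by
  obtain ⟨f, hf, hU, hχ, hd⟩ := h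
  obtain ⟨f', hf', hU', hχ', hd'⟩ := h'
  refine ⟨fun a b => f a b + f' a b, hf.add hf', fun u hu a b => ?_, fun u => ?_,
    fun a b c => ?_⟩
  · simp only [hU u hu, hU' u hu]
  · rw [AddMonoidHom.add_apply, ← hχ, ← hχ', AddCircle.coe_add]
  · simp only [IntCocycle.add, Int.cast_add, ← hd, ← hd']
    ring

/-- The restriction of integral cocycles to a subgroup. -/
def IntCocycle.restrict {V : Subgroup G} (h : V ≤ U) (n : IntCocycle U) : IntCocycle V where
  toFun := n.toFun
  isLocallyConstant := n.isLocallyConstant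
  invariant v hv := n.invariant v (h hv)
  cocycle := n.cocycle

theorem IntCocycle.RepresentsDelta.restrict {V : Subgroup G} (h : V ≤ U) {n : IntCocycle U}
    {χ : Additive U →+ QModZ} (hn : n.RepresentsDelta χ) :
    (n.restrict h).RepresentsDelta (resChar h χ) := by
  obtain ⟨f, hf, hU, hχ, hd⟩ := hn
  exact ⟨f, hf, fun v hv => hU v (h hv), fun v => hχ ⟨v, h v.2⟩, hd⟩

variable {C : CochainComplex (Rep.{w} ℤ G) ℤ}

theorem cup_add (n n' : IntCocycle U) (q r : ℤ) (hr : q + 2 = r) (c : H C U q) :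
    cup (n.add n') q r hr c = cup n q r hr c + cup n' q r hr c := by
  obtain ⟨x, hx, rfl⟩ := exists_classOf c
  rw [cup_classOf, cup_classOf, cup_classOf, ← classOf_add]
  exact classOf_congr (cupFamily_add _ _ x) _

/-- The cup product with `n` depends only on the character `χ` for which `n` represents `δ χ`. -/
theorem cup_eq_of_representsDelta {n n' : IntCocycle U} {χ : Additive U →+ QModZ}
    (h : n.RepresentsDelta χ) (h' : n'.RepresentsDelta χ) (q r : ℤ) (hr : q + 2 = r)
    (c : H C U q) : cup n q r hr c = cup n' q r hr c := by
  obtain ⟨f, hf, hU, hχ, hd⟩ := h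
  obtain ⟨f', hf', hU', hχ', hd'⟩ := h'
  have hz := coe_coboundary_eq_zero hd
  have hz' := coe_coboundary_eq_zero hd'
  set k : G → ℚ := fun a => QModZ.lift ((f 1 a - f' 1 a : ℚ) : QModZ) with hk
  have hkl : IsLocallyConstant k := by
    have h1 : IsLocallyConstant fun a : G => f 1 a :=
      hf.comp_continuous (f := fun a : G => ((1 : G), a)) (by fun_prop)
    have h2 : IsLocallyConstant fun a : G => f' 1 a :=
      hf'.comp_continuous (f := fun a : G => ((1 : G), a)) (by fun_prop)
    exact (h1.sub h2).comp fun t : ℚ => QModZ.lift (t : QModZ)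
  have hkU : ∀ u ∈ U, ∀ a, k (u * a) = k a := fun u hu a => by
    simp only [hk]
    congr 1
    simp only [AddCircle.coe_sub]
    rw [coe_mul_eq_add hU hz hu, coe_mul_eq_add hU' hz' hu, hχ ⟨u, hu⟩, hχ' ⟨u, hu⟩]
    abel
  set t : G → G → ℚ := fun a b => f a b - f' a b - (k b - k a) with ht
  have htz : ∀ a b, (t a b : QModZ) = 0 := fun a b => by
    simp only [ht, hk]
    simp only [AddCircle.coe_sub, QModZ.coe_lift]
    rw [coe_eq_sub hz 1 a b, coe_eq_sub hz' 1 a b]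
    abel
  set m : G → G → ℤ := fun a b => ⌊t a b⌋ with hm
  have hml : IsLocallyConstant fun g : G × G => m g.1 g.2 :=
    ((hf.sub hf').sub ((hkl.comp_continuous continuous_snd).sub
      (hkl.comp_continuous continuous_fst))).comp Int.floor
  have hmU : ∀ u ∈ U, ∀ a b, m (u * a) (u * b) = m a b := fun u hu a b => by
    simp only [hm, ht, hU u hu, hU' u hu, hkU u hu]
  have hdm : (fun a b c => m b c - m a c + m a b) =
      fun a b c => n.toFun a b c - n'.toFun a b c := by
    funext a b c
    have : ((m b c - m a c + m a b : ℤ) : ℚ) = ((n.toFun a b c - n'.toFun a b c : ℤ) : ℚ) := by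
      push_cast
      rw [QModZ.floor_eq (htz _ _), QModZ.floor_eq (htz _ _), QModZ.floor_eq (htz _ _), ← hd,
        ← hd']
      simp only [ht]
      ring
    exact_mod_cast this
  obtain ⟨x, hx, rfl⟩ := exists_classOf c
  rw [cup_classOf, cup_classOf, classOf_eq (r := q + 1) (by lia)]
  refine ⟨cupOne m x, cupOne_mem hml hmU rfl hx.1, ?_⟩
  have hx0 : dTot x = 0 := hx.2
  rw [dTot_cupOne, hx0, map_zero, sub_zero, hdm, cupFamily_sub]

end Characters

section Theta

variable {G : Type u} [Group G] [TopologicalSpace G] [IsTopologicalGroup G]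

/-- A continuous character of an open subgroup extends to an equivariant locally constant
function on the whole group. -/
theorem exists_equivariant (U : OpenSubgroup G) {χ : Additive (U : Subgroup G) →+ QModZ}
    (hχ : χ ∈ contChars (U : Subgroup G)) : ∃ θ : G → QModZ, IsLocallyConstant θ ∧
      (∀ (u : (U : Subgroup G)) (g : G), θ (u * g) = χ (Additive.ofMul u) + θ g) ∧
      ∀ g, ∃ u : (U : Subgroup G), θ g = χ (Additive.ofMul u) := by
  let r (g : G) : G := ((g⁻¹ : G) : G ⧸ (U : Subgroup G)).out
  have hr : ∀ g, g * r g ∈ (U : Subgroup G) := fun g => by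
    have := QuotientGroup.eq.1 (QuotientGroup.out_eq' ((g⁻¹ : G) : G ⧸ (U : Subgroup G))).symm
    simpa using this
  have hru : ∀ u ∈ (U : Subgroup G), ∀ g, r (u * g) = r g := fun u hu g => by
    refine congrArg Quotient.out (QuotientGroup.eq.2 ?_)
    simpa using hu
  have he : ∀ (u : (U : Subgroup G)) (g : G), χ (Additive.ofMul ⟨u * g * r (u * g), hr _⟩) =
      χ (Additive.ofMul u) + χ (Additive.ofMul ⟨g * r g, hr _⟩) := fun u g => by
    rw [← map_add, ← ofMul_mul]
    congr 2
    ext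
    simp [hru u u.2 g, mul_assoc]
  refine ⟨fun g => χ (Additive.ofMul ⟨g * r g, hr g⟩), ?_, he, fun g => ⟨_, rfl⟩⟩
  refine isLocallyConstant_of_mul_left
    (N := Subtype.val '' {u : (U : Subgroup G) | χ (Additive.ofMul u) = 0})
    (U.isOpen.isOpenMap_subtype_val _ (IsLocallyConstant.isOpen_fiber hχ 0))
    ⟨1, by simp, rfl⟩ ?_
  rintro _ ⟨u, hu, rfl⟩ g
  have hu' : χ (Additive.ofMul u) = 0 := hu
  simp only [he, hu', zero_add]

/-- Every continuous character of an open subgroup has an integral cocycle representing its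
coboundary. -/
theorem exists_representsDelta (U : OpenSubgroup G) {χ : Additive (U : Subgroup G) →+ QModZ}
    (hχ : χ ∈ contChars (U : Subgroup G)) :
    ∃ n : IntCocycle (U : Subgroup G), n.RepresentsDelta χ := by
  obtain ⟨θ, hθ, hθU, -⟩ := exists_equivariant U hχ
  refine ⟨IntCocycle.ofFun (fun a b => QModZ.lift (θ b - θ a)) ?_ ?_ ?_,
    IntCocycle.ofFun_representsDelta _ _ _ _ ?_⟩
  · exact ((hθ.comp_continuous continuous_snd).sub
      (hθ.comp_continuous continuous_fst)).comp QModZ.lift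
  · intro u hu a b
    have h : ∀ g, θ (u * g) = _ := hθU ⟨u, hu⟩
    simp only [h, add_sub_add_left_eq_sub]
  · intro a b c
    simp only [AddCircle.coe_sub, AddCircle.coe_add, QModZ.coe_lift]
    abel
  · intro u
    have := hθU u 1
    rw [mul_one] at this
    simp only [QModZ.coe_lift, this, add_sub_cancel_right]

end Theta

section Conjugation

variable {G : Type u} [Group G] {U V : Subgroup G}

theorem sum_out_inv_mul {M : Type*} [AddCommMonoid M] [Fintype (U ⧸ V.subgroupOf U)]
    {f : G → G → M} (hV : ∀ v ∈ V, ∀ a b, f (v * a) (v * b) = f a b) {u : G} (hu : u ∈ U)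
    (a b : G) : ∑ s : U ⧸ V.subgroupOf U, f ((s.out : G)⁻¹ * (u * a)) ((s.out : G)⁻¹ * (u * b)) =
      ∑ s : U ⧸ V.subgroupOf U, f ((s.out : G)⁻¹ * a) ((s.out : G)⁻¹ * b) := by
  refine Fintype.sum_equiv (MulAction.toPerm (⟨u, hu⟩ : U)⁻¹) _ _ fun s => ?_
  set t : U ⧸ V.subgroupOf U := MulAction.toPerm (⟨u, hu⟩ : U)⁻¹ s with ht
  have h : (s.out : G)⁻¹ * u * t.out ∈ V := by
    have : ((⟨u, hu⟩ : U)⁻¹ * s.out : U) = (t.out : U ⧸ V.subgroupOf U) := by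
      rw [QuotientGroup.out_eq', ht, MulAction.toPerm_apply]
      conv_rhs => rw [← QuotientGroup.out_eq' s]
      rfl
    have h := QuotientGroup.eq.1 this
    rw [Subgroup.mem_subgroupOf] at h
    convert h using 1
    simp [mul_assoc]
  have e : ∀ a : G, (s.out : G)⁻¹ * (u * a) =
      ((s.out : G)⁻¹ * u * t.out) * ((t.out : G)⁻¹ * a) := fun a => by group
  rw [e a, e b, hV _ h]

theorem coe_inv_mul {f : G → G → ℚ} {n : G → G → G → ℤ} {χ : Additive V →+ QModZ}
    (hU : ∀ v ∈ V, ∀ a b, f (v * a) (v * b) = f a b)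
    (hχ : ∀ v : V, ((f 1 v : ℚ) : QModZ) = χ (Additive.ofMul v))
    (hd : ∀ a b c : G, f b c - f a c + f a b = n a b c) (u v : G)
    (h : u⁻¹ * v * u ∈ V) : (f u⁻¹ (u⁻¹ * v) : QModZ) = χ (Additive.ofMul ⟨_, h⟩) := by
  have hz := coe_coboundary_eq_zero hd
  have key := coe_mul_eq_add hU hz h u⁻¹
  rw [mul_inv_cancel_right] at key
  rw [← hχ ⟨_, h⟩, coe_eq_sub hz 1, key, add_sub_cancel_right]

variable [hn : (V.subgroupOf U).Normal]

theorem conj_inv_mem (hVU : V ≤ U) (u : U) (v : V) : (u : G)⁻¹ * v * u ∈ V := by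
  have := hn.conj_mem ⟨v, hVU v.2⟩ (Subgroup.mem_subgroupOf.2 v.2) u⁻¹
  simpa [Subgroup.mem_subgroupOf] using this

/-- The character `v ↦ χ(u⁻¹ v u)` of a normal subgroup. -/
def conjChar (hVU : V ≤ U) (u : U) (χ : Additive V →+ QModZ) : Additive V →+ QModZ :=
  AddMonoidHom.mk' (fun v => χ (Additive.ofMul ⟨_, conj_inv_mem hVU u v.toMul⟩)) fun a b => by
    rw [← map_add, ← ofMul_mul]
    congr 2
    ext
    simp [mul_assoc]

end Conjugation

section Projection

variable {G : Type u} [Group G] [TopologicalSpace G] [IsTopologicalGroup G]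
  {C : CochainComplex (Rep.{w} ℤ G) ℤ} {U V : Subgroup G}

/-- The conjugate of an integral cocycle. -/
def IntCocycle.conj [hn : (V.subgroupOf U).Normal] (hVU : V ≤ U) (u : U) (n : IntCocycle V) :
    IntCocycle V where
  toFun a b c := n.toFun ((u : G)⁻¹ * a) ((u : G)⁻¹ * b) ((u : G)⁻¹ * c)
  isLocallyConstant := n.isLocallyConstant.comp_continuous
    (f := fun g : G × G × G => ((u : G)⁻¹ * g.1, (u : G)⁻¹ * g.2.1, (u : G)⁻¹ * g.2.2))
    (by fun_prop)
  invariant v hv a b c := by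
    have h : ∀ a : G, (u : G)⁻¹ * (v * a) = ((u : G)⁻¹ * v * u) * ((u : G)⁻¹ * a) := fun a => by
      group
    rw [h a, h b, h c, n.invariant _ (conj_inv_mem hVU u ⟨v, hv⟩)]
  cocycle a b c d := n.cocycle _ _ _ _

theorem IntCocycle.RepresentsDelta.conj [(V.subgroupOf U).Normal] (hVU : V ≤ U) (u : U)
    {n : IntCocycle V} {χ : Additive V →+ QModZ} (hn : n.RepresentsDelta χ) :
    (n.conj hVU u).RepresentsDelta (conjChar hVU u χ) := by
  obtain ⟨f, hf, hU, hχ, hd⟩ := hn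
  refine ⟨fun a b => f ((u : G)⁻¹ * a) ((u : G)⁻¹ * b), hf.comp_continuous
    (f := fun g : G × G => ((u : G)⁻¹ * g.1, (u : G)⁻¹ * g.2)) (by fun_prop),
    fun v hv a b => ?_, fun v => ?_, fun a b c => hd _ _ _⟩
  · have h : ∀ a : G, (u : G)⁻¹ * (v * a) = ((u : G)⁻¹ * v * u) * ((u : G)⁻¹ * a) := fun a => by
      group
    simp only [h, hU _ (conj_inv_mem hVU u ⟨v, hv⟩)]
  · simp only [mul_one]
    exact coe_inv_mul hU hχ hd u v _

theorem conj_cup [(V.subgroupOf U).Normal] (hVU : V ≤ U) (u : U) (n : IntCocycle V) (q r : ℤ)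
    (hr : q + 2 = r) (c : H C V q) :
    conj hVU r u (cup n q r hr c) = cup (n.conj hVU u) q r hr (conj hVU q u c) := by
  obtain ⟨x, hx, rfl⟩ := exists_classOf c
  exact classOf_congr (act_cupFamily _ _ _) _

/-- The projection formula `cor (b ∪ res n) = cor b ∪ n`. -/
theorem cor_cup_restrict [Finite (U ⧸ V.subgroupOf U)] (hVU : V ≤ U) (n : IntCocycle U) (q r : ℤ)
    (hr : q + 2 = r) (c : H C V q) :
    cor hVU r (cup (n.restrict hVU) q r hr c) = cup n q r hr (cor hVU q c) := by
  have := Fintype.ofFinite (U ⧸ V.subgroupOf U)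
  obtain ⟨x, hx, rfl⟩ := exists_classOf c
  rw [cup_classOf, cor_classOf, cor_classOf, cup_classOf]
  refine classOf_congr ?_ _
  rw [norm_apply, norm_apply, map_sum]
  refine Finset.sum_congr rfl fun s _ => ?_
  rw [act_cupFamily]
  simp only [IntCocycle.restrict, n.invariant _ (U.inv_mem s.out.2)]

/-- The projection formula `cor (res a ∪ n) = a ∪ cor n`; the corestriction of a character of `V`
is trivial on each subgroup of `V` that is normal in `U` and on which the character is trivial. -/
theorem exists_cor_cup_res [Finite (U ⧸ V.subgroupOf U)] (hVU : V ≤ U) {n : IntCocycle V}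
    {ψ : Additive V →+ QModZ} (hn : n.RepresentsDelta ψ) :
    ∃ (n' : IntCocycle U) (χ : Additive U →+ QModZ), n'.RepresentsDelta χ ∧
      (∀ (q r : ℤ) (hr : q + 2 = r) (c : H C U q),
        cor hVU r (cup n q r hr (res hVU q c)) = cup n' q r hr c) ∧
      ∀ (W : Subgroup G) (hWV : W ≤ V), (W.subgroupOf U).Normal →
        resChar hWV ψ = 0 → resChar (hWV.trans hVU) χ = 0 := by
  have := Fintype.ofFinite (U ⧸ V.subgroupOf U)
  obtain ⟨f, hf, hV, hψ, hd⟩ := hn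
  let f' (a b : G) : ℚ :=
    ∑ s : U ⧸ V.subgroupOf U, f ((s.out : G)⁻¹ * a) ((s.out : G)⁻¹ * b)
  have hdf : ∀ a b c : G, f' b c - f' a c + f' a b = ((∑ s : U ⧸ V.subgroupOf U,
      n.toFun ((s.out : G)⁻¹ * a) ((s.out : G)⁻¹ * b) ((s.out : G)⁻¹ * c) : ℤ) : ℚ) := by
    intro a b c
    rw [Int.cast_sum]
    simp only [← hd, f', Finset.sum_add_distrib, Finset.sum_sub_distrib]
  have hdz : ∀ a b c, ((f' b c - f' a c + f' a b : ℚ) : QModZ) = 0 := fun a b c => by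
    rw [hdf, QModZ.coe_int]
  have hfl : IsLocallyConstant fun g : G × G => f' g.1 g.2 := by
    have h : (fun g : G × G => f' g.1 g.2) = ∑ s : U ⧸ V.subgroupOf U,
        fun g : G × G => f ((s.out : G)⁻¹ * g.1) ((s.out : G)⁻¹ * g.2) := by
      funext g
      simp [f']
    rw [h]
    refine Finset.sum_induction _ IsLocallyConstant (fun _ _ h h' => h.add h')
      (IsLocallyConstant.const 0) fun s _ => ?_
    exact hf.comp_continuous
      (f := fun g : G × G => ((s.out : G)⁻¹ * g.1, (s.out : G)⁻¹ * g.2)) (by fun_prop)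
  have hfU : ∀ u ∈ U, ∀ a b, f' (u * a) (u * b) = f' a b := fun u hu a b =>
    sum_out_inv_mul hV hu a b
  refine ⟨IntCocycle.ofFun f' hfl hfU hdz, charOfFun f' hfU hdz,
    IntCocycle.ofFun_representsDelta f' hfl hfU hdz fun u => rfl, fun q r hr c => ?_,
    fun W hWV hW hψW => ?_⟩
  · obtain ⟨x, hx, rfl⟩ := exists_classOf c
    rw [res_classOf, cup_classOf, cor_classOf, cup_classOf]
    refine classOf_congr ?_ _
    have hn' : (IntCocycle.ofFun f' hfl hfU hdz).toFun = fun a b c => ∑ s : U ⧸ V.subgroupOf U,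
        n.toFun ((s.out : G)⁻¹ * a) ((s.out : G)⁻¹ * b) ((s.out : G)⁻¹ * c) := by
      funext a b c
      have h := IntCocycle.ofFun_apply f' hfl hfU hdz a b c
      rw [hdf] at h
      exact_mod_cast h
    rw [hn', cupFamily_sum, norm_apply]
    refine Finset.sum_congr rfl fun s _ => ?_
    rw [act_cupFamily, hx.1.2.2 _ s.out.2]
  · ext w
    induction w using Additive.rec with | ofMul w
    have hw : ∀ s : U, (s : G)⁻¹ * w * s ∈ W := fun s => conj_inv_mem (hWV.trans hVU) s w
    change ((f' 1 w : ℚ) : QModZ) = 0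
    simp only [f', mul_one]
    rw [← QuotientAddGroup.mk'_apply, map_sum]
    refine Finset.sum_eq_zero fun s _ => ?_
    rw [QuotientAddGroup.mk'_apply]
    refine (coe_inv_mul hV hψ hd (s.out : G) w (hWV (hw s.out))).trans ?_
    exact DFunLike.congr_fun hψW (Additive.ofMul ⟨_, hw s.out⟩)

end Projection

theorem QModZ.exists_eq_div {m : ℕ} (hm : m ≠ 0) {t : QModZ} (ht : m • t = 0) :
    ∃ k < m, t = (((k : ℚ) / m : ℚ) : QModZ) := by
  have hm' : (0 : ℚ) < m := by positivity
  have h1 : (((m : ℚ) * QModZ.lift t : ℚ) : QModZ) = 0 := by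
    rw [← nsmul_eq_mul, AddCircle.coe_nsmul, QModZ.coe_lift, ht]
  obtain ⟨z, hz⟩ := (AddCircle.coe_eq_zero_iff (1 : ℚ)).1 h1
  rw [zsmul_one] at hz
  obtain ⟨h0, h2⟩ := QModZ.lift_mem t
  have hz0 : 0 ≤ z := by
    have : (0 : ℚ) ≤ z := by rw [hz]; positivity
    exact_mod_cast this
  lift z to ℕ using hz0
  rw [Int.cast_natCast] at hz
  refine ⟨z, ?_, ?_⟩
  · have : (z : ℚ) < m := by rw [hz]; nlinarith
    exact_mod_cast this
  · rw [hz, mul_div_cancel_left₀ _ hm'.ne', QModZ.coe_lift]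

theorem QModZ.neg_one_div {m : ℕ} (hm : m ≠ 0) :
    (((m - 1 : ℕ) : ℚ) / m : ℚ) = (-(1 / m : ℚ) : QModZ) := by
  have hm' : (0 : ℚ) < m := by positivity
  have : (((m - 1 : ℕ) : ℚ) / m : ℚ) = ((1 : ℤ) : ℚ) + -(1 / m : ℚ) := by
    rw [Nat.cast_sub (Nat.one_le_iff_ne_zero.2 hm)]
    field_simp
    push_cast
    ring
  rw [this, AddCircle.coe_add, QModZ.coe_int, zero_add, AddCircle.coe_neg]

theorem QModZ.lift_add_one_div {m : ℕ} (hm : m ≠ 0) {t : QModZ} (ht : m • t = 0) :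
    QModZ.lift (t + ((1 / m : ℚ) : QModZ)) - QModZ.lift t =
      1 / m - ((if t = (-(1 / m : ℚ) : QModZ) then 1 else 0 : ℤ) : ℚ) := by
  have hm' : (0 : ℚ) < m := by positivity
  obtain ⟨k, hk, rfl⟩ := QModZ.exists_eq_div hm ht
  have hlift : ∀ i < m, QModZ.lift (((i : ℚ) / m : ℚ) : QModZ) = (i : ℚ) / m := fun i hi =>
    QModZ.lift_coe ⟨by positivity, (div_lt_one hm').2 (by exact_mod_cast hi)⟩
  have hadd : (((k : ℚ) / m : ℚ) : QModZ) + ((1 / m : ℚ) : QModZ) =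
      ((((k + 1 : ℕ) : ℚ) / m : ℚ) : QModZ) := by
    rw [← AddCircle.coe_add]
    push_cast
    rw [add_div]
  rw [hadd, hlift k hk, ← QModZ.neg_one_div hm]
  rcases (Nat.succ_le_of_lt hk).eq_or_lt with h | h
  · obtain rfl : k = m - 1 := by lia
    rw [if_pos rfl, show m - 1 + 1 = m by lia, div_self hm'.ne',
      show ((1 : ℚ) : QModZ) = ((0 : ℚ) : QModZ) by simp,
      QModZ.lift_coe (by simp), Nat.cast_sub (by lia)]
    field_simp
    push_cast
    ring
  · rw [hlift _ h, if_neg]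
    · push_cast
      ring
    · intro h'
      have := congrArg QModZ.lift h'
      rw [hlift k hk, hlift (m - 1) (by lia), div_left_inj' hm'.ne', Nat.cast_inj] at this
      lia

section Cyclic

variable {G : Type u} [Group G] {U W : Subgroup G}

theorem relIndex_nsmul_eq_zero {χ : Additive U →+ QModZ}
    (hW : ∀ u : U, (u : G) ∈ W ↔ χ (Additive.ofMul u) = 0) [(W.subgroupOf U).Normal] (u : U) :
    W.relIndex U • χ (Additive.ofMul u) = 0 := by
  rw [← map_nsmul, ← ofMul_pow, ← hW]
  exact Subgroup.mem_subgroupOf.1 (Subgroup.pow_index_mem (W.subgroupOf U) u)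

theorem eq_of_char_eq {χ : Additive U →+ QModZ}
    (hW : ∀ u : U, (u : G) ∈ W ↔ χ (Additive.ofMul u) = 0) {u u' : U} :
    (u : U ⧸ W.subgroupOf U) = u' ↔ χ (Additive.ofMul u) = χ (Additive.ofMul u') := by
  rw [QuotientGroup.eq, Subgroup.mem_subgroupOf, hW, ofMul_mul, map_add, ofMul_inv, map_neg,
    neg_add_eq_zero]

theorem exists_char_eq_neg_one_div {χ : Additive U →+ QModZ} [Finite (U ⧸ W.subgroupOf U)]
    (hW : ∀ u : U, (u : G) ∈ W ↔ χ (Additive.ofMul u) = 0) [(W.subgroupOf U).Normal] :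
    ∃ σ : U, χ (Additive.ofMul σ) = (-(1 / (W.relIndex U : ℚ) : ℚ) : QModZ) := by
  have hm : W.relIndex U ≠ 0 := Subgroup.index_ne_zero_of_finite
  choose k hk hχ using fun u : U => QModZ.exists_eq_div hm (relIndex_nsmul_eq_zero hW u)
  let κ (s : U ⧸ W.subgroupOf U) : Fin (W.relIndex U) := ⟨k s.out, hk _⟩
  have hκ : Function.Injective κ := fun s s' h => by
    rw [← QuotientGroup.out_eq' s, ← QuotientGroup.out_eq' s', eq_of_char_eq hW, hχ, hχ]
    rw [show k s.out = k s'.out from congrArg Fin.val h]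
  have e : (U ⧸ W.subgroupOf U) ≃ Fin (W.relIndex U) := Finite.equivFin _
  obtain ⟨s, hs⟩ := (Finite.injective_iff_surjective_of_equiv e).1 hκ
    ⟨W.relIndex U - 1, by lia⟩
  refine ⟨s.out, ?_⟩
  rw [hχ, show k s.out = W.relIndex U - 1 from congrArg Fin.val hs, QModZ.neg_one_div hm]

variable [TopologicalSpace G]

/-- Explicit cochains that compute the cup product with `δ χ` for a character `χ` of `U` with
kernel `W` and an element `σ` that generates `U / W`. -/
structure CyclicData (U W : Subgroup G) [Fintype (U ⧸ W.subgroupOf U)]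
    (χ : Additive U →+ QModZ) where
  n : IntCocycle U
  representsDelta : n.RepresentsDelta χ
  σ : U
  generates : ∀ u : U, ∃ k : ℕ, ((σ : G) ^ k)⁻¹ * u ∈ W
  φ : G → ℤ
  φ_locallyConstant : IsLocallyConstant φ
  φ_invariant : ∀ v ∈ W, ∀ a, φ (v * a) = φ a
  sum_φ : ∀ g, ∑ s : U ⧸ W.subgroupOf U, φ ((s.out : G)⁻¹ * g) = 1
  ψ : G → G → ℤ
  ψ_locallyConstant : IsLocallyConstant fun g : G × G => ψ g.1 g.2
  ψ_invariant : ∀ v ∈ W, ∀ a b, ψ (v * a) (v * b) = ψ a b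
  ψ_σ : ∀ a b, ψ ((σ : G)⁻¹ * a) ((σ : G)⁻¹ * b) - ψ a b = φ b - φ a
  dψ : ∀ a b c, ψ b c - ψ a c + ψ a b = n.toFun a b c

theorem exists_cyclicData [IsTopologicalGroup G] (U : OpenSubgroup G) {W : Subgroup G}
    [(W.subgroupOf (U : Subgroup G)).Normal]
    [Fintype ((U : Subgroup G) ⧸ W.subgroupOf (U : Subgroup G))] (hWU : W ≤ (U : Subgroup G))
    {χ : Additive (U : Subgroup G) →+ QModZ} (hχ : χ ∈ contChars (U : Subgroup G))
    (hW : ∀ u : (U : Subgroup G), (u : G) ∈ W ↔ χ (Additive.ofMul u) = 0) :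
    Nonempty (CyclicData (U : Subgroup G) W χ) := by
  obtain ⟨θ, hθ, hθU, hθr⟩ := exists_equivariant U hχ
  obtain ⟨σ, hσ⟩ := exists_char_eq_neg_one_div hW
  set m := W.relIndex (U : Subgroup G) with hm
  have hm0 : m ≠ 0 := Subgroup.index_ne_zero_of_finite
  have hθ1 : IsLocallyConstant fun g : G × G => θ g.1 := hθ.comp_continuous continuous_fst
  have hθ2 : IsLocallyConstant fun g : G × G => θ g.2 := hθ.comp_continuous continuous_snd
  have hθW : ∀ v ∈ W, ∀ g, θ (v * g) = θ g := fun v hv g => by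
    rw [show θ (v * g) = _ from hθU ⟨v, hWU hv⟩ g, (hW ⟨v, hWU hv⟩).1 hv, zero_add]
  have hθi : ∀ (u : (U : Subgroup G)) (g : G),
      θ ((u : G)⁻¹ * g) = θ g - χ (Additive.ofMul u) := fun u g => by
    rw [eq_sub_iff_add_eq, add_comm, ← hθU, mul_inv_cancel_left]
  let f (a b : G) : ℚ := QModZ.lift (θ b - θ a)
  have hfl : IsLocallyConstant fun g : G × G => f g.1 g.2 := (hθ2.sub hθ1).comp QModZ.lift
  have hfU : ∀ u ∈ (U : Subgroup G), ∀ a b, f (u * a) (u * b) = f a b := fun u hu a b => by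
    have h : ∀ g, θ (u * g) = _ := hθU ⟨u, hu⟩
    simp only [f, h, add_sub_add_left_eq_sub]
  have hfd : ∀ a b c, ((f b c - f a c + f a b : ℚ) : QModZ) = 0 := fun a b c => by
    simp only [f, AddCircle.coe_sub, AddCircle.coe_add, QModZ.coe_lift]
    abel
  have hf1 : ∀ u : (U : Subgroup G), ((f 1 u : ℚ) : QModZ) = χ (Additive.ofMul u) := fun u => by
    have := hθU u 1
    rw [mul_one] at this
    simp only [f, QModZ.coe_lift, this, add_sub_cancel_right]
  let r (a b : G) : ℚ := f a b - QModZ.lift (θ b) + QModZ.lift (θ a)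
  have hr : ∀ a b, (⌊r a b⌋ : ℚ) = r a b := fun a b => QModZ.floor_eq <| by
    simp only [r, f, AddCircle.coe_sub, AddCircle.coe_add, QModZ.coe_lift]
    abel
  refine ⟨{
    n := IntCocycle.ofFun f hfl hfU hfd
    representsDelta := IntCocycle.ofFun_representsDelta f hfl hfU hfd hf1
    σ := σ
    generates := fun u => ?_
    φ := fun g => if θ g = χ (Additive.ofMul σ) then 1 else 0
    φ_locallyConstant := hθ.comp fun t => if t = χ (Additive.ofMul σ) then 1 else 0
    φ_invariant := fun v hv a => by simp only [hθW v hv]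
    sum_φ := fun g => ?_
    ψ := fun a b => ⌊r a b⌋
    ψ_locallyConstant := ((hfl.sub (hθ2.comp QModZ.lift)).add (hθ1.comp QModZ.lift)).comp
      Int.floor
    ψ_invariant := fun v hv a b => by simp only [r, hfU v (hWU hv), hθW v hv]
    ψ_σ := fun a b => ?_
    dψ := fun a b c => ?_ }⟩
  · obtain ⟨k, -, hk⟩ := QModZ.exists_eq_div hm0
      (relIndex_nsmul_eq_zero hW u⁻¹)
    refine ⟨k, ?_⟩
    have h : (u : G)⁻¹ * (σ : G) ^ k ∈ W := by
      have := (hW (u⁻¹ * σ ^ k)).2 (by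
        rw [ofMul_mul, map_add, hk, ofMul_pow, map_nsmul, hσ, ← AddCircle.coe_neg,
          ← AddCircle.coe_nsmul, ← AddCircle.coe_add, nsmul_eq_mul]
        simp [div_eq_mul_inv])
      simpa using this
    simpa using W.inv_mem h
  · obtain ⟨u, hu⟩ := hθr g
    have h : ∀ s : (U : Subgroup G) ⧸ W.subgroupOf (U : Subgroup G),
        (θ ((s.out : G)⁻¹ * g) = χ (Additive.ofMul σ)) ↔
          s = ((u * σ⁻¹ : (U : Subgroup G)) :
            (U : Subgroup G) ⧸ W.subgroupOf (U : Subgroup G)) := by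
      intro s
      conv_rhs => rw [← QuotientGroup.out_eq' s, eq_of_char_eq hW]
      rw [hθi, hu, ofMul_mul, map_add, ofMul_inv, map_neg, sub_eq_iff_eq_add', ← sub_eq_add_neg,
        eq_sub_iff_add_eq, eq_comm]
    rw [Fintype.sum_eq_single _ fun s hs => if_neg fun h' => hs ((h s).1 h'),
      if_pos ((h _).2 rfl)]
  · have hl : ∀ g, QModZ.lift (θ ((σ : G)⁻¹ * g)) - QModZ.lift (θ g) =
        1 / m - ((if θ g = χ (Additive.ofMul σ) then 1 else 0 : ℤ) : ℚ) := fun g => by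
      obtain ⟨u, hu⟩ := hθr g
      rw [hθi, hσ, sub_neg_eq_add]
      exact QModZ.lift_add_one_div hm0 (by rw [hu]; exact relIndex_nsmul_eq_zero hW u)
    have h : ((⌊r ((σ : G)⁻¹ * a) ((σ : G)⁻¹ * b)⌋ - ⌊r a b⌋ : ℤ) : ℚ) =
        (((if θ b = χ (Additive.ofMul σ) then 1 else 0) -
          (if θ a = χ (Additive.ofMul σ) then 1 else 0) : ℤ) : ℚ) := by
      rw [Int.cast_sub, Int.cast_sub, hr, hr]
      simp only [r]
      have ha := hl a
      have hb := hl b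
      rw [hfU _ (Subgroup.inv_mem _ σ.2)]
      linear_combination ha - hb
    exact_mod_cast h
  · have h : ((⌊r b c⌋ - ⌊r a c⌋ + ⌊r a b⌋ : ℤ) : ℚ) =
        ((IntCocycle.ofFun f hfl hfU hfd).toFun a b c : ℚ) := by
      rw [IntCocycle.ofFun_apply]
      push_cast
      rw [hr, hr, hr]
      simp only [r]
      ring
    exact_mod_cast h

end Cyclic

section Action

variable {G : Type u} [Group G] {C : CochainComplex (Rep.{w} ℤ G) ℤ}

theorem act_one (x : Family C) : act 1 x = x := by
  funext p j g
  simp [act_apply]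

theorem act_act_inv (u : G) (x : Family C) : act u (act u⁻¹ x) = x := by
  rw [← act_mul, mul_inv_cancel, act_one]

end Action

section CyclicCohomology

variable {G : Type u} [Group G] [TopologicalSpace G]
  {C : CochainComplex (Rep.{w} ℤ G) ℤ} {U W : Subgroup G}

theorem exists_dTot_eq (h1 : Subsingleton (H C W 1)) {x : Family C} (hx : x ∈ cocycles C W 1) :
    ∃ y ∈ cochains C W 0, dTot y = x :=
  (classOf_eq_zero (q := 1) (r := 0) (by norm_num) hx).1 (Subsingleton.elim _ _)

variable [Fintype (U ⧸ W.subgroupOf U)] {χ : Additive U →+ QModZ}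

namespace CyclicData

variable (D : CyclicData U W χ)

theorem norm_cupZero {x : Family C} (hx : ∀ u ∈ U, act u x = x) :
    norm U W (cupZero D.φ x) = x := by
  rw [norm_apply]
  simp only [act_cupZero]
  rw [Finset.sum_congr rfl fun (s : U ⧸ W.subgroupOf U) _ => by rw [hx _ s.out.2],
    ← cupZero_sum]
  simp only [D.sum_φ, cupZero_one]

theorem act_cupOne_sub {x : Family C} (hx : x ∈ cocycles C U 0) :
    act (D.σ : G) (cupOne D.ψ x) - cupOne D.ψ x = dTot (cupZero D.φ x) := by
  have hx0 : dTot x = 0 := hx.2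
  rw [act_cupOne, hx.1.2.2 _ D.σ.2, ← cupOne_sub, dTot_cupZero, hx0, map_zero, zero_add]
  simp only [D.ψ_σ]

theorem dTot_cupOne_ψ {x : Family C} (hx : x ∈ cocycles C U 0) :
    dTot (cupOne D.ψ x) = cupFamily D.n.toFun x := by
  have hx0 : dTot x = 0 := hx.2
  rw [dTot_cupOne, hx0, map_zero, sub_zero]
  simp only [D.dψ]

variable [ContinuousMul G]

section

variable [(W.subgroupOf U).Normal] {q : ℤ}

theorem exists_act_sub (hWU : W ≤ U) {z : Family C} (hz : z ∈ cochains C W q) (u : U) :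
    ∃ h ∈ cochains C W q, act (D.σ : G) h - h = act (u : G) z - z := by
  obtain ⟨k, hk⟩ := D.generates u
  have : act (u : G) z = act ((D.σ : G) ^ k) z := by
    rw [← mul_inv_cancel_left ((D.σ : G) ^ k) (u : G), act_mul, hz.2.2 _ hk]
  rw [this]
  clear this hk
  induction k with
  | zero => exact ⟨0, zero_mem _, by simp [act_one]⟩
  | succ k ih =>
    obtain ⟨h, hh, e⟩ := ih
    refine ⟨h + act ((D.σ : G) ^ k) z,
      add_mem hh (act_mem (U.pow_mem D.σ.2 k) hWU hz), ?_⟩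
    rw [pow_succ', act_mul, map_add, add_sub_add_comm, e]
    abel

/-- The cochains that are invariant under `W` have trivial Tate cohomology in degree `-1`. -/
theorem exists_of_norm_eq_zero (hWU : W ≤ U) {x : Family C} (hx : x ∈ cochains C W q)
    (h0 : norm U W x = 0) :
    ∃ h ∈ cochains C W q, act (D.σ : G) h - h = x := by
  have hinv : ∀ u : U, act (u : G)⁻¹ x ∈ cochains C W q := fun u =>
    act_mem (U.inv_mem u.2) hWU hx
  choose h hh e using fun s : U ⧸ W.subgroupOf U => D.exists_act_sub hWU
    (cupZero_mem D.φ_locallyConstant D.φ_invariant (hinv s.out)) s.out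
  refine ⟨∑ s, h s, sum_mem fun s _ => hh s, ?_⟩
  rw [map_sum, ← Finset.sum_sub_distrib, Finset.sum_congr rfl fun s _ => e s,
    Finset.sum_sub_distrib, ← map_sum, ← norm_eq_sum_inv hx.2.2, h0, map_zero, sub_zero]
  simp only [act_cupZero, act_act_inv]
  rw [← cupZero_sum]
  simp only [D.sum_φ, cupZero_one]

end

variable [(W.subgroupOf U).Normal]

theorem exists_cor_eq (hWU : W ≤ U) (h1 : Subsingleton (H C W 1)) (a : H C U 0)
    (ha : cup D.n 0 2 rfl a = 0) :
    ∃ b, cor hWU 0 b = a := by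
  obtain ⟨x, hx, rfl⟩ := exists_classOf a
  rw [cup_classOf, classOf_eq_zero (r := 1) rfl] at ha
  obtain ⟨f, hf, hfx⟩ := ha
  have he : cupOne D.ψ x ∈ cochains C W 1 :=
    cupOne_mem D.ψ_locallyConstant D.ψ_invariant rfl (cochains_mono hWU 0 hx.1)
  have hb : cupZero D.φ x ∈ cochains C W 0 :=
    cupZero_mem D.φ_locallyConstant D.φ_invariant (cochains_mono hWU 0 hx.1)
  obtain ⟨k, hk, hke⟩ := exists_dTot_eq h1 (x := cupOne D.ψ x - f)
    (mem_cocycles.2 ⟨sub_mem he (cochains_mono hWU 1 hf), by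
      rw [map_sub, D.dTot_cupOne_ψ hx, hfx, sub_self]⟩)
  have hσk : act (D.σ : G) k ∈ cochains C W 0 := act_mem D.σ.2 hWU hk
  have hy : cupZero D.φ x - (act (D.σ : G) k - k) ∈ cocycles C W 0 := by
    refine mem_cocycles.2 ⟨sub_mem hb (sub_mem hσk hk), ?_⟩
    rw [map_sub, map_sub, ← act_dTot, hke, map_sub, hf.2.2 _ D.σ.2, ← D.act_cupOne_sub hx]
    abel
  refine ⟨classOf _ hy, ?_⟩
  rw [cor_classOf]
  refine classOf_congr ?_ _
  rw [map_sub, map_sub, norm_act D.σ hk.2.2, sub_self, sub_zero, D.norm_cupZero hx.1.2.2]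

theorem exists_cup_eq (hWU : W ≤ U) (h1 : Subsingleton (H C W 1)) (c : H C U 2)
    (hc : res hWU 2 c = 0) :
    ∃ a, cup D.n 0 2 rfl a = c := by
  obtain ⟨z, hz, rfl⟩ := exists_classOf c
  rw [res_classOf, classOf_eq_zero (r := 1) rfl] at hc
  obtain ⟨e, he, rfl⟩ := hc
  have hσe : act (D.σ : G) e ∈ cochains C W 1 := act_mem D.σ.2 hWU he
  obtain ⟨b, hb, hbe⟩ := exists_dTot_eq h1 (x := act (D.σ : G) e - e)
    (mem_cocycles.2 ⟨sub_mem hσe he, by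
      rw [map_sub, ← act_dTot, hz.1.2.2 _ D.σ.2, sub_self]⟩)
  have hx : norm U W b ∈ cocycles C U 0 := by
    refine mem_cocycles.2 ⟨norm_mem U W 0 b hb, ?_⟩
    rw [dTot_norm, hbe, map_sub, norm_act D.σ he.2.2, sub_self]
  have hb' : cupZero D.φ (norm U W b) ∈ cochains C W 0 :=
    cupZero_mem D.φ_locallyConstant D.φ_invariant (cochains_mono hWU 0 hx.1)
  have he' : cupOne D.ψ (norm U W b) ∈ cochains C W 1 :=
    cupOne_mem D.ψ_locallyConstant D.ψ_invariant rfl (cochains_mono hWU 0 hx.1)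
  obtain ⟨h, hh, hhe⟩ := D.exists_of_norm_eq_zero hWU (sub_mem hb' hb) (by
    rw [map_sub, D.norm_cupZero hx.1.2.2, sub_self])
  refine ⟨classOf _ hx, ?_⟩
  rw [cup_classOf, classOf_eq (r := 1) rfl]
  set y := cupOne D.ψ (norm U W b) - e - dTot h with hy
  have hyW : y ∈ cochains C W 1 := sub_mem (sub_mem he' he) (dTot_mem rfl hh)
  have hσy : act (D.σ : G) y = y := by
    rw [← sub_eq_zero, hy, map_sub, map_sub, act_dTot]
    have h2 := D.act_cupOne_sub hx
    have h3 := congrArg dTot hhe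
    rw [map_sub, map_sub, ← h2, hbe] at h3
    rw [← sub_eq_zero] at h3
    rw [← neg_eq_zero, ← h3]
    abel
  have hyU : ∀ u ∈ U, act u y = y := fun u hu => by
    obtain ⟨k, hk⟩ := D.generates ⟨u, hu⟩
    have hσk : ∀ k : ℕ, act ((D.σ : G) ^ k) y = y := fun k => by
      induction k with
      | zero => simp [act_one]
      | succ k ih => rw [pow_succ, act_mul, hσy, ih]
    rw [← mul_inv_cancel_left ((D.σ : G) ^ k) u, act_mul, hyW.2.2 _ hk, hσk]
  refine ⟨y, ⟨hyW.1, hyW.2.1, hyU⟩, ?_⟩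
  rw [hy, map_sub, map_sub, dTot_dTot, sub_zero, D.dTot_cupOne_ψ hx]

end CyclicData

end CyclicCohomology

section Duality

/-- A homomorphism on a group of characters is, on finitely many characters of finite order, the
evaluation at some element. -/
theorem exists_apply_eq {A : Type*} [AddGroup A] {X : AddSubgroup (A →+ QModZ)} (φ : X →+ QModZ)
    {ι : Type*} [Fintype ι] (χ : ι → X) {m : ℕ} (hm : m ≠ 0) (hχ : ∀ i, m • χ i = 0) :
    ∃ a : A, ∀ i, (χ i : A →+ QModZ) a = φ (χ i) := by
  classical
  let B : AddSubgroup (ι → ℤ) :=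
    { carrier := {x | ∃ a : A, ∀ i, (χ i : A →+ QModZ) a = x i • ((1 / m : ℚ) : QModZ)}
      zero_mem' := ⟨0, fun i => by simp⟩
      add_mem' := by
        rintro x y ⟨a, ha⟩ ⟨b, hb⟩
        exact ⟨a + b, fun i => by rw [map_add, ha, hb, Pi.add_apply, add_smul]⟩
      neg_mem' := by
        rintro x ⟨a, ha⟩
        exact ⟨-a, fun i => by rw [map_neg, ha, Pi.neg_apply, neg_smul]⟩ }
  have hdiv : ∀ {t : QModZ}, m • t = 0 → ∃ k : ℤ, t = k • ((1 / m : ℚ) : QModZ) := fun ht => by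
    obtain ⟨k, -, rfl⟩ := QModZ.exists_eq_div hm ht
    refine ⟨k, ?_⟩
    rw [natCast_zsmul, ← AddCircle.coe_nsmul, nsmul_eq_mul, mul_one_div]
  choose y hy using fun i => hdiv (t := φ (χ i)) (by rw [← map_nsmul, hχ, map_zero])
  by_contra hcon
  have hyB : y ∉ B := by
    rintro ⟨a, ha⟩
    exact hcon ⟨a, fun i => (ha i).trans (hy i).symm⟩
  obtain ⟨c, hc⟩ := CharacterModule.exists_character_apply_ne_zero_of_ne_zero
    (a := (QuotientAddGroup.mk y : (ι → ℤ) ⧸ B)) (by rwa [Ne, QuotientAddGroup.eq_zero_iff])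
  let l : (ι → ℤ) →+ QModZ := AddMonoidHom.comp c (QuotientAddGroup.mk' B)
  have hlB : ∀ x ∈ B, l x = 0 := fun x hx => by
    change c (QuotientAddGroup.mk x) = 0
    rw [(QuotientAddGroup.eq_zero_iff x).2 hx, map_zero]
  have hl : ∀ x, l x = ∑ i, x i • l (Pi.single i 1) := fun x => by
    conv_lhs => rw [← Finset.univ_sum_single x, map_sum]
    refine Finset.sum_congr rfl fun i _ => ?_
    rw [← map_zsmul, ← Pi.single_smul]
    simp
  choose k hk using fun i => hdiv (t := l (Pi.single i 1)) (by
    rw [← map_nsmul]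
    refine hlB _ ⟨0, fun j => ?_⟩
    have hm' : (m : ℚ) ≠ 0 := Nat.cast_ne_zero.2 hm
    have h1 : m • ((1 / m : ℚ) : QModZ) = 0 := by
      rw [← AddCircle.coe_nsmul, nsmul_eq_mul, mul_one_div_cancel hm']
      simp
    rw [map_zero, Pi.smul_apply, smul_assoc, smul_comm, h1, smul_zero])
  have hsum : ∑ i, k i • χ i = 0 := by
    ext a
    choose x hx using fun i => hdiv (t := (χ i : A →+ QModZ) a) (by
      have := DFunLike.congr_fun (congrArg Subtype.val (hχ i)) a
      simpa using this)
    have : l x = 0 := hlB x ⟨a, hx⟩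
    rw [hl] at this
    simp only [AddSubgroup.val_finsetSum, AddSubgroup.coe_zsmul, AddMonoidHom.finsetSum_apply,
      AddMonoidHom.smul_apply, ZeroMemClass.coe_zero, AddMonoidHom.zero_apply, ← this, hx, hk]
    exact Finset.sum_congr rfl fun i _ => smul_comm _ _ _
  refine hc ?_
  change l y = 0
  rw [hl, ← φ.map_zero, ← hsum, map_sum]
  refine Finset.sum_congr rfl fun i _ => ?_
  rw [map_zsmul, hy, hk, smul_comm]

variable {G : Type u} [Group G] [TopologicalSpace G] [IsTopologicalGroup G]

theorem exists_nsmul_contChars_eq_zero {U : Subgroup G} [CompactSpace U] (χ : contChars U) :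
    ∃ m : ℕ, m ≠ 0 ∧ m • χ = 0 := by
  let f : U →* Multiplicative QModZ := AddMonoidHom.toMultiplicativeRight (χ : Additive U →+ QModZ)
  have ho : IsOpen (f.ker : Set U) := IsLocallyConstant.isOpen_fiber χ.2 0
  have : Finite (U ⧸ f.ker) := Subgroup.quotient_finite_of_isOpen _ ho
  refine ⟨f.ker.index, Subgroup.index_ne_zero_of_finite, ?_⟩
  ext u
  induction u using Additive.rec with | ofMul u
  have h : f (u ^ f.ker.index) = 1 := Subgroup.pow_index_mem f.ker u
  have h' : (χ : Additive U →+ QModZ) (f.ker.index • Additive.ofMul u) = 0 := h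
  rwa [map_nsmul] at h'

/-- Pontryagin duality for compact groups: a homomorphism on the group of continuous characters
into `ℚ/ℤ` is the evaluation at some element. -/
theorem exists_eval_eq {U : Subgroup G} [CompactSpace U] (φ : contChars U →+ QModZ) :
    ∃ u : U, ∀ χ : contChars U, (χ : Additive U →+ QModZ) (Additive.ofMul u) = φ χ := by
  obtain ⟨u, hu⟩ := CompactSpace.iInter_nonempty
    (t := fun χ : contChars U => {u : U | (χ : Additive U →+ QModZ) (Additive.ofMul u) = φ χ})
    (fun χ => (IsLocallyConstant.isClosed_fiber χ.2 _)) fun S => by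
      choose m hm hmχ using exists_nsmul_contChars_eq_zero (U := U)
      obtain ⟨a, ha⟩ := exists_apply_eq φ (fun i : S => (i : contChars U))
        (m := ∏ i ∈ S, m i) (Finset.prod_ne_zero_iff.2 fun i _ => hm i) fun i => by
          obtain ⟨d, hd⟩ := Finset.dvd_prod_of_mem m i.2
          rw [hd, mul_comm, mul_smul, hmχ, smul_zero]
      exact ⟨a.toMul, Set.mem_iInter₂.2 fun i hi => ha ⟨i, hi⟩⟩
  exact ⟨u, fun χ => Set.mem_iInter.1 hu χ⟩

/-- A continuous character as a character of the topological abelianization. -/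
def descend {U : Subgroup G} (χ : contChars U) : Ab U →+ QModZ :=
  let f : U →* Multiplicative QModZ := AddMonoidHom.toMultiplicativeRight (χ : Additive U →+ QModZ)
  let g : TopologicalAbelianization U →* Multiplicative QModZ :=
    QuotientGroup.lift (commutator U).topologicalClosure f <| by
      have ho : IsOpen (f.ker : Set U) := IsLocallyConstant.isOpen_fiber χ.2 0
      exact Subgroup.topologicalClosure_minimal _ (Abelianization.commutator_subset_ker f)
        (Subgroup.isClosed_of_isOpen _ ho)
  MonoidHom.toAdditiveLeft g

theorem toAb_surjective (U : Subgroup G) : Function.Surjective (toAb U) :=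
  QuotientGroup.mk'_surjective (commutator U).topologicalClosure

/-- Characters with values in `ℚ/ℤ` separate the elements of an abelian quotient. -/
theorem mem_of_char_eq_zero {U : Type*} [Group U] {N : Subgroup U} (hN : commutator U ≤ N) {u : U}
    (h : ∀ χ : Additive U →+ QModZ, (∀ v ∈ N, χ (Additive.ofMul v) = 0) →
      χ (Additive.ofMul u) = 0) : u ∈ N := by
  let N' : AddSubgroup (Additive (Abelianization U)) :=
    Subgroup.toAddSubgroup (N.map Abelianization.of)
  let π : Additive U →+ Additive (Abelianization U) ⧸ N' :=
    (QuotientAddGroup.mk' N').comp (MonoidHom.toAdditive Abelianization.of)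
  have hπ : ∀ v : U, π (Additive.ofMul v) = 0 ↔ v ∈ N := fun v => by
    have h1 : π (Additive.ofMul v) = 0 ↔ Abelianization.of v ∈ N.map Abelianization.of :=
      QuotientAddGroup.eq_zero_iff _
    rw [h1, ← Subgroup.mem_comap, Subgroup.comap_map_eq_self]
    rwa [Abelianization.ker_of]
  rw [← hπ]
  refine CharacterModule.eq_zero_of_character_apply fun c =>
    h (AddMonoidHom.comp c π) fun v hv => ?_
  change c (π (Additive.ofMul v)) = 0
  rw [(hπ v).2 hv, map_zero]

theorem mem_contChars_of_isOpen {U : Subgroup G} {N : Subgroup U} (hN : IsOpen (N : Set U))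
    {χ : Additive U →+ QModZ} (h : ∀ v ∈ N, χ (Additive.ofMul v) = 0) : χ ∈ contChars U :=
  isLocallyConstant_of_mul_left hN N.one_mem fun v hv g => by
    rw [ofMul_mul, map_add, h v hv, zero_add]

theorem exists_contChar_ne_zero {U : Subgroup G} [CompactSpace U] [TotallyDisconnectedSpace U]
    {t : Ab U} (ht : t ≠ 0) : ∃ χ : contChars U, descend χ t ≠ 0 := by
  obtain ⟨u, rfl⟩ := toAb_surjective U t
  induction u using Additive.rec with | ofMul u
  have hu : u ∉ (commutator U).topologicalClosure := fun h =>
    ht ((QuotientGroup.eq_one_iff u).2 h)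
  let K : ClosedSubgroup U := ⟨(commutator U).topologicalClosure,
    Subgroup.isClosed_topologicalClosure _⟩
  have hK : u ∉ (K : Subgroup U) := hu
  rw [ProfiniteGrp.closedSubgroup_eq_sInf_open K, Subgroup.mem_sInf] at hK
  push Not at hK
  obtain ⟨N, ⟨hNo, hKN⟩, huN⟩ := hK
  by_contra! h
  exact huN (mem_of_char_eq_zero ((Subgroup.le_topologicalClosure _).trans hKN) fun χ hχ =>
    h ⟨χ, mem_contChars_of_isOpen hNo hχ⟩)

theorem ext_contChars {U : Subgroup G} [CompactSpace U] [TotallyDisconnectedSpace U]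
    {s t : Ab U} (h : ∀ χ : contChars U, descend χ s = descend χ t) : s = t := by
  by_contra hst
  obtain ⟨χ, hχ⟩ := exists_contChar_ne_zero (sub_ne_zero.2 hst)
  exact hχ (by rw [map_sub, h, sub_self])

end Duality

section Reciprocity

variable {G : Type u} [Group G] [TopologicalSpace G]

/-- The kernel of a continuous character of an open subgroup of `G`, as an open subgroup of `G`. -/
def kerOpen {U : OpenSubgroup G} (χ : contChars (U : Subgroup G)) : OpenSubgroup G where
  toSubgroup := (AddMonoidHom.toMultiplicativeRight
    (χ : Additive (U : Subgroup G) →+ QModZ)).ker.map (U : Subgroup G).subtype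
  isOpen' := U.isOpen.isOpenMap_subtype_val _ (IsLocallyConstant.isOpen_fiber χ.2 0)

theorem kerOpen_le {U : OpenSubgroup G} (χ : contChars (U : Subgroup G)) :
    (kerOpen χ : Subgroup G) ≤ U :=
  Subgroup.map_subtype_le _

theorem mem_kerOpen {U : OpenSubgroup G} (χ : contChars (U : Subgroup G)) (u : (U : Subgroup G)) :
    (u : G) ∈ (kerOpen χ : Subgroup G) ↔
      (χ : Additive (U : Subgroup G) →+ QModZ) (Additive.ofMul u) = 0 :=
  Subgroup.mem_map_iff_mem Subtype.val_injective

instance kerOpen_normal {U : OpenSubgroup G} (χ : contChars (U : Subgroup G)) :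
    ((kerOpen χ : Subgroup G).subgroupOf (U : Subgroup G)).Normal where
  conj_mem v hv u := by
    rw [Subgroup.mem_subgroupOf, mem_kerOpen] at hv ⊢
    rw [ofMul_mul, ofMul_mul, map_add, map_add, hv, add_zero, ofMul_inv, map_neg, add_neg_cancel]

variable [IsTopologicalGroup G]

/-- An integral cocycle that represents the coboundary of a continuous character. -/
def deltaCocycle {U : OpenSubgroup G} (χ : contChars (U : Subgroup G)) :
    IntCocycle (U : Subgroup G) :=
  (exists_representsDelta U χ.2).choose

theorem deltaCocycle_representsDelta {U : OpenSubgroup G} (χ : contChars (U : Subgroup G)) :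
    (deltaCocycle χ).RepresentsDelta (χ : Additive (U : Subgroup G) →+ QModZ) :=
  (exists_representsDelta U χ.2).choose_spec

theorem exists_cyclicData_kerOpen {U : OpenSubgroup G} (χ : contChars (U : Subgroup G))
    [Fintype ((U : Subgroup G) ⧸ (kerOpen χ : Subgroup G).subgroupOf (U : Subgroup G))] :
    Nonempty (CyclicData (U : Subgroup G) (kerOpen χ : Subgroup G) χ.1) :=
  exists_cyclicData U (kerOpen_le χ) χ.2 (mem_kerOpen χ)

variable {C : CochainComplex (Rep.{w} ℤ G) ℤ}

namespace GeneralizedClassFormation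

variable (F : GeneralizedClassFormation C)

/-- The pairing `(a, χ) ↦ inv_U (a ∪ δ χ)`. -/
def pairing (U : OpenSubgroup G) :
    H C (U : Subgroup G) 0 →+ contChars (U : Subgroup G) →+ QModZ where
  toFun a := AddMonoidHom.mk' (fun χ => F.inv U (cup (deltaCocycle χ) 0 2 rfl a)) fun χ χ' => by
    rw [← map_add, ← cup_add]
    exact congrArg _ (cup_eq_of_representsDelta (deltaCocycle_representsDelta (χ + χ'))
      ((deltaCocycle_representsDelta χ).add (deltaCocycle_representsDelta χ')) 0 2 rfl a)
  map_zero' := by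
    ext χ
    simp
  map_add' a b := by
    ext χ
    simp

theorem pairing_eq {U : OpenSubgroup G} {n : IntCocycle (U : Subgroup G)}
    (χ : contChars (U : Subgroup G))
    (h : n.RepresentsDelta (χ : Additive (U : Subgroup G) →+ QModZ)) (a : H C (U : Subgroup G) 0) :
    F.pairing U a χ = F.inv U (cup n 0 2 rfl a) :=
  congrArg (F.inv U) (cup_eq_of_representsDelta (deltaCocycle_representsDelta χ) h 0 2 rfl a)

variable [CompactSpace G]

theorem pairing_cor {U V : OpenSubgroup G} (hVU : (V : Subgroup G) ≤ U)
    (χ : contChars (U : Subgroup G)) (b : H C (V : Subgroup G) 0) :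
    F.pairing U (cor hVU 0 b) χ = F.pairing V b ⟨_, resChar_mem hVU χ.2⟩ := by
  have h := deltaCocycle_representsDelta χ
  rw [F.pairing_eq χ h, F.pairing_eq ⟨_, resChar_mem hVU χ.2⟩ (h.restrict hVU), ← F.inv_cor hVU]
  exact congrArg (F.inv U) (cor_cup_restrict hVU _ 0 2 rfl b).symm

theorem pairing_conj {U V : OpenSubgroup G} (hVU : (V : Subgroup G) ≤ U)
    [((V : Subgroup G).subgroupOf U).Normal] (u : (U : Subgroup G))
    (χ : contChars (V : Subgroup G)) (b : H C (V : Subgroup G) 0) :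
    F.pairing V (conj hVU 0 u b) ⟨conjChar hVU u χ,
      ((deltaCocycle_representsDelta χ).conj hVU u).mem_contChars⟩ = F.pairing V b χ := by
  have h := deltaCocycle_representsDelta χ
  rw [F.pairing_eq _ (h.conj hVU u), F.pairing_eq χ h,
    ← F.inv_conj hVU u (cup (deltaCocycle χ) 0 2 rfl b)]
  exact congrArg (F.inv V) (conj_cup hVU u _ 0 2 rfl b).symm

theorem exists_pairing_res {U V : OpenSubgroup G} (hVU : (V : Subgroup G) ≤ U)
    (ψ : contChars (V : Subgroup G)) : ∃ χ : contChars (U : Subgroup G),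
      (∀ a, F.pairing V (res hVU 0 a) ψ = F.pairing U a χ) ∧
      ∀ (W : Subgroup G) (hWV : W ≤ V), (W.subgroupOf (U : Subgroup G)).Normal →
        resChar hWV ψ.1 = 0 → resChar (hWV.trans hVU) χ.1 = 0 := by
  have h := deltaCocycle_representsDelta ψ
  obtain ⟨n', χ, hχ, hc, hW⟩ := exists_cor_cup_res (C := C) hVU h
  refine ⟨⟨χ, hχ.mem_contChars⟩, fun a => ?_, hW⟩
  rw [F.pairing_eq ψ h, F.pairing_eq ⟨χ, hχ.mem_contChars⟩ hχ, ← hc, F.inv_cor hVU]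

theorem exists_pairing_ne_zero {U : OpenSubgroup G} {χ : contChars (U : Subgroup G)}
    (hχ : χ ≠ 0) : ∃ a, F.pairing U a χ ≠ 0 := by
  have := Fintype.ofFinite
    ((U : Subgroup G) ⧸ (kerOpen χ : Subgroup G).subgroupOf (U : Subgroup G))
  obtain ⟨D⟩ := exists_cyclicData_kerOpen χ
  set m := (kerOpen χ : Subgroup G).relIndex U with hm
  have hm0 : m ≠ 0 := relIndex_ne_zero U (kerOpen χ)
  have hm1 : m ≠ 1 := fun h => hχ <| by
    rw [hm, Subgroup.relIndex_eq_one] at h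
    ext u
    exact (mem_kerOpen χ u).1 (h u.2)
  obtain ⟨c, hc⟩ := (F.inv U).surjective ((1 / m : ℚ) : QModZ)
  have hres : res (kerOpen_le χ) 2 c = 0 := by
    rw [← map_eq_zero_iff _ (F.inv (kerOpen χ)).injective, F.inv_res, hc, ← hm,
      ← AddCircle.coe_nsmul, nsmul_eq_mul, mul_one_div_cancel (Nat.cast_ne_zero.2 hm0)]
    simp
  obtain ⟨a, rfl⟩ := D.exists_cup_eq (kerOpen_le χ) (F.h1 (kerOpen χ)) c hres
  refine ⟨a, ?_⟩
  rw [F.pairing_eq χ D.representsDelta, hc]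
  intro h0
  have hm' : (1 : ℚ) < m := by exact_mod_cast (show 1 < m by lia)
  have h2 := QModZ.lift_coe (a := 1 / m) ⟨by positivity, (div_lt_one (by linarith)).2 hm'⟩
  have h3 := QModZ.lift_coe (a := 0) ⟨le_rfl, one_pos⟩
  rw [h0, ← AddCircle.coe_zero, h3] at h2
  have : (0 : ℚ) < 1 / m := by positivity
  linarith

instance compactSpace_openSubgroup (U : OpenSubgroup G) : CompactSpace (U : Subgroup G) :=
  isCompact_iff_compactSpace.1 U.isClosed.isCompact

theorem exists_ab (U : OpenSubgroup G) (a : H C (U : Subgroup G) 0) :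
    ∃ t : Ab (U : Subgroup G), ∀ χ, descend χ t = F.pairing U a χ := by
  obtain ⟨u, hu⟩ := exists_eval_eq (F.pairing U a)
  exact ⟨toAb _ (Additive.ofMul u), hu⟩

variable [TotallyDisconnectedSpace G]

/-- The reciprocity map. -/
def reciprocity (U : OpenSubgroup G) : H C (U : Subgroup G) 0 →+ Ab (U : Subgroup G) :=
  AddMonoidHom.mk' (fun a => (F.exists_ab U a).choose) fun a b => ext_contChars fun χ => by
    have h := fun a => (F.exists_ab U a).choose_spec χ
    refine (h (a + b)).trans ?_
    rw [map_add (F.pairing U), AddMonoidHom.add_apply, map_add (descend χ), h a, h b]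

theorem descend_reciprocity {U : OpenSubgroup G} (χ : contChars (U : Subgroup G))
    (a : H C (U : Subgroup G) 0) : descend χ (F.reciprocity U a) = F.pairing U a χ :=
  (F.exists_ab U a).choose_spec χ

theorem isReciprocityMap_reciprocity (U : OpenSubgroup G) :
    F.IsReciprocityMap U (F.reciprocity U) := by
  intro χ n hn a
  rw [← F.pairing_eq ⟨_, hn.mem_contChars⟩ hn, ← descend_reciprocity]
  obtain ⟨u, hu⟩ := toAb_surjective _ (F.reciprocity U a)
  rw [← hu]
  rfl

theorem eq_reciprocity {U : OpenSubgroup G} {ρ : H C (U : Subgroup G) 0 →+ Ab (U : Subgroup G)}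
    (h : F.IsReciprocityMap U ρ) : ρ = F.reciprocity U := by
  refine DFunLike.ext _ _ fun a => ext_contChars fun χ => ?_
  rw [descend_reciprocity, ← h (descend χ) _ (deltaCocycle_representsDelta χ) a]
  rfl

theorem exists_toAb_eq (U : OpenSubgroup G) (a : H C (U : Subgroup G) 0) :
    ∃ u : (U : Subgroup G), toAb _ (Additive.ofMul u) = F.reciprocity U a ∧
      ∀ χ : contChars (U : Subgroup G), F.pairing U a χ = χ.1 (Additive.ofMul u) := by
  obtain ⟨u, hu⟩ := toAb_surjective _ (F.reciprocity U a)
  refine ⟨u.toMul, hu, fun χ => ?_⟩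
  rw [← descend_reciprocity, ← hu]
  rfl

/-- The reciprocity map is surjective modulo each open normal subgroup. -/
theorem exists_pairing_eq {U V : OpenSubgroup G} (hVU : (V : Subgroup G) ≤ U)
    (u : (U : Subgroup G)) :
    ∃ a, ∀ χ : contChars (U : Subgroup G), resChar hVU χ.1 = 0 →
      F.pairing U a χ = χ.1 (Additive.ofMul u) := by
  let N : Subgroup (U : Subgroup G) :=
    { carrier := {u | ∃ a, ∀ χ : contChars (U : Subgroup G), resChar hVU χ.1 = 0 →
        F.pairing U a χ = χ.1 (Additive.ofMul u)}
      one_mem' := ⟨0, fun χ _ => by simp⟩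
      mul_mem' := by
        rintro u v ⟨a, ha⟩ ⟨b, hb⟩
        refine ⟨a + b, fun χ h => ?_⟩
        rw [map_add, AddMonoidHom.add_apply, ha χ h, hb χ h, ofMul_mul, map_add]
      inv_mem' := by
        rintro u ⟨a, ha⟩
        refine ⟨-a, fun χ h => ?_⟩
        rw [map_neg, AddMonoidHom.neg_apply, ha χ h, ofMul_inv, map_neg] }
  have hVN : (V : Subgroup G).subgroupOf U ≤ N := fun v hv => ⟨0, fun χ h => by
    have h1 := DFunLike.congr_fun h (Additive.ofMul ⟨v, Subgroup.mem_subgroupOf.1 hv⟩)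
    rw [map_zero, AddMonoidHom.zero_apply]
    exact h1.symm⟩
  have hN : IsOpen (N : Set (U : Subgroup G)) :=
    Subgroup.isOpen_mono hVN (Subgroup.subgroupOf_isOpen _ _ V.isOpen)
  have hcN : commutator (U : Subgroup G) ≤ N := by
    rw [commutator_eq_closure, Subgroup.closure_le]
    rintro _ ⟨x, y, rfl⟩
    refine ⟨0, fun χ _ => ?_⟩
    rw [map_zero, AddMonoidHom.zero_apply, commutatorElement_def, ofMul_mul, ofMul_mul, ofMul_mul,
      map_add, map_add, map_add, ofMul_inv, ofMul_inv, map_neg, map_neg]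
    abel
  refine mem_of_char_eq_zero hcN fun χ hχ => ?_
  have hχc := mem_contChars_of_isOpen hN hχ
  by_contra h0
  obtain ⟨a, ha⟩ := F.exists_pairing_ne_zero (χ := ⟨χ, hχc⟩) fun h => h0 <| by
    rw [show χ = 0 from congrArg Subtype.val h, AddMonoidHom.zero_apply]
  obtain ⟨u', -, hu'⟩ := F.exists_toAb_eq U a
  refine ha ?_
  rw [hu']
  exact hχ u' ⟨a, fun χ _ => hu' χ⟩

end GeneralizedClassFormation

end Reciprocity

theorem normal_subgroupOf_of_le {G : Type*} [Group G] {U W V : Subgroup G} (hWU : W ≤ U)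
    (hVW : V ≤ W)
    [(V.subgroupOf U).Normal] : (V.subgroupOf W).Normal where
  conj_mem v hv w := by
    have := conj_inv_mem (hVW.trans hWU) ⟨w, hWU w.2⟩⁻¹ ⟨v, hv⟩
    simpa [Subgroup.mem_subgroupOf] using this

section Kernel

variable {G : Type u} [Group G] [TopologicalSpace G] [IsTopologicalGroup G] [CompactSpace G]

theorem exists_char_of_isPGroup {p : ℕ} [Fact p.Prime] {U V : OpenSubgroup G}
    (hVU : (V : Subgroup G) ≤ U) [((V : Subgroup G).subgroupOf (U : Subgroup G)).Normal]
    (hp : IsPGroup p ((U : Subgroup G) ⧸ (V : Subgroup G).subgroupOf (U : Subgroup G)))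
    (hUV : ¬ (U : Subgroup G) ≤ V) :
    ∃ χ : contChars (U : Subgroup G), resChar hVU χ.1 = 0 ∧ χ ≠ 0 := by
  set Q := (U : Subgroup G) ⧸ (V : Subgroup G).subgroupOf (U : Subgroup G)
  have hQ : Nontrivial Q :=
    QuotientGroup.nontrivial_iff.2 fun h => hUV (Subgroup.subgroupOf_eq_top.1 h)
  have := hp.isNilpotent
  obtain ⟨q, -, hq⟩ := SetLike.exists_of_lt (Group.IsSolvable.commutator_lt_top_of_nontrivial Q)
  obtain ⟨u, rfl⟩ := QuotientGroup.mk_surjective q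
  let N : Subgroup (U : Subgroup G) := (commutator Q).comap (QuotientGroup.mk' _)
  have hVN : (V : Subgroup G).subgroupOf (U : Subgroup G) ≤ N := fun v hv => by
    rw [Subgroup.mem_comap, QuotientGroup.mk'_apply, (QuotientGroup.eq_one_iff v).2 hv]
    exact one_mem _
  have hcN : commutator (U : Subgroup G) ≤ N := by
    rw [← Subgroup.map_le_iff_le_comap, commutator_def, Subgroup.map_commutator]
    exact Subgroup.commutator_mono le_top le_top
  by_contra! h
  refine hq (show u ∈ N from mem_of_char_eq_zero hcN fun χ hχ => ?_)
  have hχc : χ ∈ contChars (U : Subgroup G) := mem_contChars_of_isOpen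
    (Subgroup.isOpen_mono hVN (Subgroup.subgroupOf_isOpen _ _ V.isOpen)) hχ
  have := h ⟨χ, hχc⟩ (by
    ext v
    induction v using Additive.rec with | ofMul v
    exact hχ ⟨v, hVU v.2⟩ (hVN (Subgroup.mem_subgroupOf.2 v.2)))
  rw [show χ = 0 from congrArg Subtype.val this, AddMonoidHom.zero_apply]

variable [TotallyDisconnectedSpace G] {C : CochainComplex (Rep.{w} ℤ G) ℤ}

namespace GeneralizedClassFormation

variable (F : GeneralizedClassFormation C)

theorem exists_conj_sub {U W V : OpenSubgroup G} (hWU : (W : Subgroup G) ≤ U)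
    (hVW : (V : Subgroup G) ≤ W) [((W : Subgroup G).subgroupOf (U : Subgroup G)).Normal]
    [hVn : ((V : Subgroup G).subgroupOf (U : Subgroup G)).Normal] (σ : (U : Subgroup G))
    (hσ : ∀ u : (U : Subgroup G), ∃ k : ℕ, ((σ : G) ^ k)⁻¹ * u ∈ (W : Subgroup G))
    (w : (W : Subgroup G))
    (hw : ∀ χ : contChars (U : Subgroup G), resChar (hVW.trans hWU) χ.1 = 0 →
      χ.1 (Additive.ofMul ⟨w, hWU w.2⟩) = 0) :
    ∃ c : H C (W : Subgroup G) 0, ∀ χ : contChars (W : Subgroup G), resChar hVW χ.1 = 0 →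
      F.pairing W (conj hWU 0 σ c - c) χ = χ.1 (Additive.ofMul w) := by
  let K : Subgroup (U : Subgroup G) :=
    { carrier := {k | ∃ (hk : (k : G) ∈ (W : Subgroup G)) (c : H C (W : Subgroup G) 0),
        ∀ χ : contChars (W : Subgroup G), resChar hVW χ.1 = 0 →
          F.pairing W (conj hWU 0 σ c - c) χ = χ.1 (Additive.ofMul ⟨k, hk⟩)}
      one_mem' := ⟨one_mem _, 0, fun χ _ => by
        rw [map_zero, sub_zero, map_zero, AddMonoidHom.zero_apply]
        exact (map_zero χ.1).symm⟩
      mul_mem' := by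
        rintro x y ⟨hx, c, hc⟩ ⟨hy, d, hd⟩
        refine ⟨mul_mem hx hy, c + d, fun χ h => ?_⟩
        rw [map_add, add_sub_add_comm, map_add, AddMonoidHom.add_apply, hc χ h, hd χ h,
          ← map_add]
        rfl
      inv_mem' := by
        rintro x ⟨hx, c, hc⟩
        refine ⟨inv_mem hx, -c, fun χ h => ?_⟩
        rw [map_neg, ← neg_sub', map_neg, AddMonoidHom.neg_apply, hc χ h, ← map_neg]
        rfl }
  have hKσ : ∀ x : (W : Subgroup G), (σ * ⟨x, hWU x.2⟩ * σ⁻¹ * (⟨x, hWU x.2⟩ : (U : Subgroup G))⁻¹)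
      ∈ K := fun x => by
    have hx : (σ : G) * x * (σ : G)⁻¹ ∈ (W : Subgroup G) := by
      simpa using conj_inv_mem hWU σ⁻¹ x
    obtain ⟨c, hc⟩ := F.exists_pairing_eq hVW x
    refine ⟨mul_mem hx (inv_mem x.2), c, fun χ h => ?_⟩
    let χ' : contChars (W : Subgroup G) := ⟨conjChar hWU σ⁻¹ χ,
      ((deltaCocycle_representsDelta χ).conj hWU σ⁻¹).mem_contChars⟩
    have hχ' : resChar hVW χ'.1 = 0 := by
      ext v
      induction v using Additive.rec with | ofMul v
      exact DFunLike.congr_fun h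
        (Additive.ofMul ⟨_, conj_inv_mem (hVW.trans hWU) σ⁻¹ v⟩)
    have hχ : χ = ⟨conjChar hWU σ χ',
        ((deltaCocycle_representsDelta χ').conj hWU σ).mem_contChars⟩ := by
      ext v
      induction v using Additive.rec with | ofMul v
      refine congrArg (fun y => χ.1 (Additive.ofMul y)) (Subtype.ext (a1 := v)
        (a2 := ⟨_, conj_inv_mem hWU σ⁻¹ ⟨_, conj_inv_mem hWU σ v⟩⟩) ?_)
      simp [mul_assoc]
    have h1 : F.pairing W (conj hWU 0 σ c) χ = F.pairing W c χ' := by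
      conv_lhs => rw [hχ]
      exact F.pairing_conj hWU σ χ' c
    have h2 : χ'.1 (Additive.ofMul x) = χ.1 (Additive.ofMul ⟨_, hx⟩) := by
      change χ.1 (Additive.ofMul _) = _
      congr 2
      ext
      simp
    rw [map_sub, AddMonoidHom.sub_apply, h1, hc χ' hχ', hc χ h, h2, ← map_sub, sub_eq_add_neg]
    rfl
  have hKW : ∀ x y : (W : Subgroup G), ((⟨x, hWU x.2⟩ : (U : Subgroup G)) * ⟨y, hWU y.2⟩ *
      (⟨x, hWU x.2⟩ : (U : Subgroup G))⁻¹ * (⟨y, hWU y.2⟩ : (U : Subgroup G))⁻¹) ∈ K := by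
    intro x y
    refine ⟨(x * y * x⁻¹ * y⁻¹).2, 0, fun χ _ => ?_⟩
    rw [map_zero, sub_zero, map_zero, AddMonoidHom.zero_apply]
    change 0 = χ.1 (Additive.ofMul x + Additive.ofMul y + -Additive.ofMul x + -Additive.ofMul y)
    simp only [map_add, map_neg]
    abel
  have hconj : ∀ (u y : (U : Subgroup G)), (y : G) ∈ (W : Subgroup G) →
      ((u * y * u⁻¹ : (U : Subgroup G)) : G) ∈ (W : Subgroup G) := fun u y hy => by
    simpa using conj_inv_mem hWU u⁻¹ ⟨y, hy⟩
  have hσk : ∀ (k : ℕ) (y : (U : Subgroup G)), (y : G) ∈ (W : Subgroup G) →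
      σ ^ k * y * (σ ^ k)⁻¹ * y⁻¹ ∈ K := fun k => by
    induction k with
    | zero => intro y _; simp
    | succ k ih =>
      intro y hy
      have h := K.mul_mem (ih _ (hconj σ y hy)) (hKσ ⟨y, hy⟩)
      convert h using 1
      group
  have hK : ∀ (u y : (U : Subgroup G)), (y : G) ∈ (W : Subgroup G) →
      u * y * u⁻¹ * y⁻¹ ∈ K := fun u y hy => by
    obtain ⟨k, hk⟩ := hσ u
    have hz : (((σ ^ k)⁻¹ * u : (U : Subgroup G)) : G) ∈ (W : Subgroup G) := by simpa using hk
    have h := K.mul_mem (hσk k _ (hconj ((σ ^ k)⁻¹ * u) y hy)) (hKW ⟨_, hz⟩ ⟨y, hy⟩)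
    convert h using 1
    ext
    simp [mul_assoc]
  have hKn : K.Normal := ⟨fun y hy u => by
    have h := K.mul_mem (hK u y hy.1) hy
    simpa [mul_assoc] using h⟩
  have hcomm : ∀ (u y : (U : Subgroup G)), (y : G) ∈ (W : Subgroup G) →
      Commute (u : (U : Subgroup G) ⧸ K) y := fun u y hy => by
    have h := (QuotientGroup.eq_one_iff _).2 (hK u y hy)
    rw [← commutatorElement_eq_one_iff_commute, commutatorElement_def]
    exact h
  have hcK : commutator (U : Subgroup G) ≤ K := by
    rw [commutator_eq_closure, Subgroup.closure_le]
    rintro _ ⟨x, y, rfl⟩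
    have hdec : ∀ x : (U : Subgroup G), ∃ (k : ℕ) (z : (U : Subgroup G)),
        (z : G) ∈ (W : Subgroup G) ∧ x = σ ^ k * z := fun x => by
      obtain ⟨k, hk⟩ := hσ x
      exact ⟨k, (σ ^ k)⁻¹ * x, by simpa using hk, by group⟩
    obtain ⟨i, z, hz, hxz⟩ := hdec x
    obtain ⟨j, z', hz', hyz⟩ := hdec y
    have h : Commute (x : (U : Subgroup G) ⧸ K) y := by
      rw [hyz, QuotientGroup.mk_mul]
      refine Commute.mul_right ?_ (hcomm x z' hz')
      rw [hxz, QuotientGroup.mk_mul]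
      refine Commute.mul_left ?_ (hcomm _ z hz).symm
      rw [QuotientGroup.mk_pow, QuotientGroup.mk_pow]
      exact Commute.pow_pow_self _ _ _
    rw [SetLike.mem_coe, ← QuotientGroup.eq_one_iff]
    exact commutatorElement_eq_one_iff_commute.2 h
  have hVK : (V : Subgroup G).subgroupOf U ≤ K := fun v hv => by
    have hv' := Subgroup.mem_subgroupOf.1 hv
    refine ⟨hVW hv', 0, fun χ h => ?_⟩
    rw [map_zero, sub_zero, map_zero, AddMonoidHom.zero_apply]
    exact (DFunLike.congr_fun h (Additive.ofMul ⟨_, hv'⟩)).symm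
  have hKo : IsOpen (K : Set (U : Subgroup G)) :=
    Subgroup.isOpen_mono hVK (Subgroup.subgroupOf_isOpen _ _ V.isOpen)
  obtain ⟨_, c, hc⟩ : (⟨w, hWU w.2⟩ : (U : Subgroup G)) ∈ K :=
    mem_of_char_eq_zero hcK fun χ hχ => hw ⟨χ, mem_contChars_of_isOpen hKo hχ⟩ <| by
      ext v
      induction v using Additive.rec with | ofMul v
      exact hχ ⟨v, hWU (hVW v.2)⟩ (hVK (Subgroup.mem_subgroupOf.2 v.2))
  exact ⟨c, hc⟩

/-- If `U / V` is a `p`-group, then a class that pairs trivially with all characters of `U / V` is a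
corestriction. -/
theorem exists_cor_eq_of_isPGroup (p : ℕ) [Fact p.Prime] {V : OpenSubgroup G} (n : ℕ) :
    ∀ {U : OpenSubgroup G} (hVU : (V : Subgroup G) ≤ U)
      [((V : Subgroup G).subgroupOf (U : Subgroup G)).Normal],
      (V : Subgroup G).relIndex U = n →
      (∀ u : (U : Subgroup G), ∃ k : ℕ, (u : G) ^ p ^ k ∈ (V : Subgroup G)) →
      ∀ a : H C (U : Subgroup G) 0, (∀ χ : contChars (U : Subgroup G), resChar hVU χ.1 = 0 →
        F.pairing U a χ = 0) → ∃ b, cor hVU 0 b = a := by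
  induction n using Nat.strong_induction_on with
  | _ n ih =>
  intro U hVU hVn hn hp a ha
  by_cases hUV : (U : Subgroup G) ≤ V
  · obtain rfl : U = V := OpenSubgroup.toSubgroup_injective (le_antisymm hUV hVU)
    exact ⟨a, cor_self a⟩
  obtain ⟨χ, hχV, hχ⟩ := exists_char_of_isPGroup (p := p) hVU (fun q => by
    obtain ⟨u, rfl⟩ := QuotientGroup.mk_surjective q
    obtain ⟨k, hk⟩ := hp u
    exact ⟨k, (QuotientGroup.eq_one_iff (u ^ p ^ k)).2 (Subgroup.mem_subgroupOf.2 hk)⟩) hUV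
  have hWU := kerOpen_le χ
  have hVW : (V : Subgroup G) ≤ kerOpen χ := fun v hv =>
    (mem_kerOpen χ ⟨v, hVU hv⟩).2 (DFunLike.congr_fun hχV (Additive.ofMul ⟨v, hv⟩))
  have := Fintype.ofFinite
    ((U : Subgroup G) ⧸ (kerOpen χ : Subgroup G).subgroupOf (U : Subgroup G))
  obtain ⟨D⟩ := exists_cyclicData_kerOpen χ
  obtain ⟨b, rfl⟩ := D.exists_cor_eq hWU (F.h1 (kerOpen χ)) a (by
    rw [← map_eq_zero_iff _ (F.inv U).injective, ← F.pairing_eq χ D.representsDelta, ha χ hχV])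
  have := normal_subgroupOf_of_le hWU hVW
  obtain ⟨w, -, hw⟩ := F.exists_toAb_eq _ b
  obtain ⟨c, hc⟩ := F.exists_conj_sub hWU hVW D.σ D.generates w fun χ' h => by
    rw [← ha χ' h, F.pairing_cor hWU, hw]
    rfl
  have hlt : (V : Subgroup G).relIndex (kerOpen χ : Subgroup G) < n := by
    rw [← hn, ← Subgroup.relIndex_mul_relIndex _ _ _ hVW hWU]
    refine lt_mul_of_one_lt_right (Nat.pos_of_ne_zero (relIndex_ne_zero _ _)) ?_
    have h0 := relIndex_ne_zero U (kerOpen χ)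
    have h1 : (kerOpen χ : Subgroup G).relIndex U ≠ 1 := fun h => hχ <| by
      rw [Subgroup.relIndex_eq_one] at h
      ext u
      exact (mem_kerOpen χ u).1 (h u.2)
    lia
  obtain ⟨d, hd⟩ := ih _ hlt hVW rfl (fun u => hp ⟨u, hWU u.2⟩) (b - (conj hWU 0 D.σ c - c))
    fun χ' h => by rw [map_sub, AddMonoidHom.sub_apply, hw, hc χ' h, sub_self]
  refine ⟨d, ?_⟩
  rw [← cor_cor hWU hVW, hd, map_sub, map_sub, cor_conj, sub_self, sub_zero]

theorem exists_cor_eq {U V : OpenSubgroup G} (hVU : (V : Subgroup G) ≤ U)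
    [((V : Subgroup G).subgroupOf (U : Subgroup G)).Normal] (a : H C (U : Subgroup G) 0)
    (ha : ∀ χ : contChars (U : Subgroup G), resChar hVU χ.1 = 0 → F.pairing U a χ = 0) :
    ∃ b, cor hVU 0 b = a := by
  have key : ∀ p : ℕ, p.Prime → ∃ m : ℕ, ¬ p ∣ m ∧ m • a ∈ (cor (C := C) hVU 0).range := by
    intro p hp
    have := Fact.mk hp
    let P : Sylow p ((U : Subgroup G) ⧸ (V : Subgroup G).subgroupOf (U : Subgroup G)) := default
    let P' : Subgroup (U : Subgroup G) := P.toSubgroup.comap (QuotientGroup.mk' _)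
    have hVP : (V : Subgroup G).subgroupOf (U : Subgroup G) ≤ P' := fun v hv => by
      rw [Subgroup.mem_comap, QuotientGroup.mk'_apply, (QuotientGroup.eq_one_iff v).2 hv]
      exact one_mem _
    have hPo : IsOpen (P' : Set (U : Subgroup G)) :=
      Subgroup.isOpen_mono hVP (Subgroup.subgroupOf_isOpen _ _ V.isOpen)
    obtain ⟨W, hW⟩ : ∃ W : OpenSubgroup G,
        (W : Subgroup G) = P'.map (U : Subgroup G).subtype :=
      ⟨⟨_, U.isOpen.isOpenMap_subtype_val _ hPo⟩, rfl⟩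
    have hWU : (W : Subgroup G) ≤ U := hW.trans_le (Subgroup.map_subtype_le _)
    have hVW : (V : Subgroup G) ≤ W := fun v hv =>
      hW ▸ ⟨⟨v, hVU hv⟩, hVP (Subgroup.mem_subgroupOf.2 hv), rfl⟩
    have hindex : (W : Subgroup G).relIndex U = P.index := by
      have h : (W : Subgroup G).subgroupOf U = P' :=
        hW ▸ Subgroup.comap_map_eq_self_of_injective Subtype.val_injective P'
      rw [Subgroup.relIndex, h]
      exact Subgroup.index_comap_of_surjective _ (QuotientGroup.mk'_surjective _)
    have := normal_subgroupOf_of_le hWU hVW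
    obtain ⟨d, hd⟩ := F.exists_cor_eq_of_isPGroup p _ hVW rfl (fun u => by
      obtain ⟨x, hx, hxu⟩ := hW.le u.2
      obtain ⟨k, hk⟩ := P.isPGroup' ⟨_, hx⟩
      refine ⟨k, ?_⟩
      have h1 : ((x ^ p ^ k : (U : Subgroup G)) :
          (U : Subgroup G) ⧸ (V : Subgroup G).subgroupOf (U : Subgroup G)) = 1 :=
        congrArg Subtype.val hk
      rw [QuotientGroup.eq_one_iff, Subgroup.mem_subgroupOf] at h1
      rw [← hxu]
      exact h1) (res hWU 0 a) fun ψ hψ => by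
        obtain ⟨χ, hχ, hχV⟩ := F.exists_pairing_res hWU ψ
        rw [hχ, ha χ (hχV _ hVW inferInstance hψ)]
    refine ⟨P.index, P.not_dvd_index, d, ?_⟩
    rw [← cor_cor hWU hVW, hd, cor_res, hindex]
  have h1 : addOrderOf (QuotientAddGroup.mk a : _ ⧸ (cor (C := C) hVU 0).range) = 1 := by
    by_contra h
    obtain ⟨p, hp, hpd⟩ := Nat.exists_prime_and_dvd h
    obtain ⟨m, hm, hma⟩ := key p hp
    refine hm (hpd.trans (addOrderOf_dvd_of_nsmul_eq_zero ?_))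
    exact (QuotientAddGroup.eq_zero_iff (m • a)).2 hma
  exact (QuotientAddGroup.eq_zero_iff a).1 (AddMonoid.addOrderOf_eq_one_iff.1 h1)

end GeneralizedClassFormation

end Kernel

section Main

variable {G : Type u} [Group G] [TopologicalSpace G] [IsTopologicalGroup G]

/-- The kernel of `U → (U/V)^ab` is detected by the characters that are trivial on `V`. -/
theorem abProj_toAb_eq_zero {U V : OpenSubgroup G} (hVU : (V : Subgroup G) ≤ U)
    [((V : Subgroup G).subgroupOf (U : Subgroup G)).Normal] (u : (U : Subgroup G)) :
    abProj U V (toAb _ (Additive.ofMul u)) = 0 ↔ ∀ χ : contChars (U : Subgroup G),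
      resChar hVU χ.1 = 0 → χ.1 (Additive.ofMul u) = 0 := by
  let π : (U : Subgroup G) →*
      Abelianization ((U : Subgroup G) ⧸ (V : Subgroup G).subgroupOf (U : Subgroup G)) :=
    Abelianization.of.comp (QuotientGroup.mk' _)
  have hV : (V : Subgroup G).subgroupOf (U : Subgroup G) ≤ π.ker := fun v hv => by
    rw [MonoidHom.mem_ker, MonoidHom.comp_apply, QuotientGroup.mk'_apply,
      (QuotientGroup.eq_one_iff v).2 hv, map_one]
  have ho : IsOpen (π.ker : Set (U : Subgroup G)) :=
    Subgroup.isOpen_mono hV (Subgroup.subgroupOf_isOpen _ _ V.isOpen)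
  constructor
  · intro h χ hχ
    let f : (U : Subgroup G) →* Multiplicative QModZ := AddMonoidHom.toMultiplicativeRight χ.1
    let g : (U : Subgroup G) ⧸ (V : Subgroup G).subgroupOf (U : Subgroup G) →*
        Multiplicative QModZ := QuotientGroup.lift _ f fun v hv =>
      MonoidHom.mem_ker.2 (show f v = 1 from
        DFunLike.congr_fun hχ (Additive.ofMul ⟨v, Subgroup.mem_subgroupOf.1 hv⟩))
    have h1 : Abelianization.lift g (π u) = 1 := by
      rw [show π u = 1 from h, map_one]
    exact h1
  · intro h
    have hu : u ∈ π.ker := mem_of_char_eq_zero (Abelianization.commutator_subset_ker π)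
      fun χ hχ => h ⟨χ, mem_contChars_of_isOpen ho hχ⟩ <| by
        ext v
        induction v using Additive.rec with | ofMul v
        exact hχ ⟨v, hVU v.2⟩ (hV (Subgroup.mem_subgroupOf.2 v.2))
    exact hu

variable [CompactSpace G] [TotallyDisconnectedSpace G] {C : CochainComplex (Rep.{w} ℤ G) ℤ}

namespace GeneralizedClassFormation

variable (F : GeneralizedClassFormation C)

theorem abProj_reciprocity_eq_zero {U V : OpenSubgroup G} (hVU : (V : Subgroup G) ≤ U)
    [((V : Subgroup G).subgroupOf (U : Subgroup G)).Normal] (a : H C (U : Subgroup G) 0) :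
    abProj U V (F.reciprocity U a) = 0 ↔ a ∈ (cor (C := C) hVU 0).range := by
  obtain ⟨u, hu, hχ⟩ := F.exists_toAb_eq U a
  rw [← hu, abProj_toAb_eq_zero hVU]
  constructor
  · exact fun h => F.exists_cor_eq hVU a fun χ hV => (hχ χ).trans (h χ hV)
  · rintro ⟨b, rfl⟩ χ hV
    rw [← hχ, F.pairing_cor hVU, show (⟨_, resChar_mem hVU χ.2⟩ : contChars (V : Subgroup G)) = 0
      from Subtype.ext hV, map_zero]

theorem exists_abProj_reciprocity_eq {U V : OpenSubgroup G} (hVU : (V : Subgroup G) ≤ U)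
    [((V : Subgroup G).subgroupOf (U : Subgroup G)).Normal] (u : (U : Subgroup G)) :
    ∃ a, abProj U V (F.reciprocity U a) = abProj U V (toAb _ (Additive.ofMul u)) := by
  obtain ⟨a, ha⟩ := F.exists_pairing_eq hVU u
  obtain ⟨v, hv, hχ⟩ := F.exists_toAb_eq U a
  refine ⟨a, ?_⟩
  rw [← hv, ← sub_eq_zero, ← map_sub, ← map_sub]
  refine (abProj_toAb_eq_zero hVU (v / u)).2 fun χ hV => ?_
  rw [ofMul_div, map_sub, ← hχ, ha χ hV, sub_self]

theorem denseRange_reciprocity (U : OpenSubgroup G) : DenseRange (F.reciprocity U) := by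
  intro t
  obtain ⟨u, rfl⟩ := toAb_surjective _ t
  induction u using Additive.rec with | ofMul u
  rw [mem_closure_iff]
  intro O hO hu
  have hc : Continuous fun v : (U : Subgroup G) => toAb _ (Additive.ofMul (u * v)) :=
    (continuous_quot_mk : Continuous
      (QuotientGroup.mk' (commutator (U : Subgroup G)).topologicalClosure)).comp
      (continuous_const.mul continuous_id)
  obtain ⟨N, hN⟩ := ProfiniteGrp.exist_openNormalSubgroup_sub_open_nhds_of_one
    (hO.preimage hc) (by simpa using hu)
  obtain ⟨V, hV⟩ : ∃ V : OpenSubgroup G,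
      (V : Subgroup G) = (N : Subgroup (U : Subgroup G)).map (U : Subgroup G).subtype :=
    ⟨⟨_, U.isOpen.isOpenMap_subtype_val _ N.isOpen'⟩, rfl⟩
  have hVU : (V : Subgroup G) ≤ U := hV.trans_le (Subgroup.map_subtype_le _)
  have hVN : (V : Subgroup G).subgroupOf U = N :=
    hV ▸ Subgroup.comap_map_eq_self_of_injective Subtype.val_injective _
  have : ((V : Subgroup G).subgroupOf (U : Subgroup G)).Normal := hVN ▸ N.isNormal'
  obtain ⟨a, ha⟩ := F.exists_abProj_reciprocity_eq hVU u
  obtain ⟨v, hv, -⟩ := F.exists_toAb_eq U a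
  refine ⟨_, ?_, a, rfl⟩
  have hmem : u⁻¹ * v ∈ commutator (U : Subgroup G) ⊔ N := by
    refine mem_of_char_eq_zero le_sup_left fun χ hχ => ?_
    rw [← hv, ← sub_eq_zero, ← map_sub, ← map_sub] at ha
    have hN' : ∀ x ∈ (N : Subgroup (U : Subgroup G)), χ (Additive.ofMul x) = 0 :=
      fun x hx => hχ x (Subgroup.mem_sup_right hx)
    have := (abProj_toAb_eq_zero hVU (v / u)).1 ha
      ⟨χ, mem_contChars_of_isOpen N.isOpen' hN'⟩ (by
        ext x
        induction x using Additive.rec with | ofMul x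
        exact hN' ⟨x, hVU x.2⟩ (hVN.le (Subgroup.mem_subgroupOf.2 x.2)))
    rw [ofMul_mul, map_add, ofMul_inv, map_neg, neg_add_eq_sub, ← map_sub]
    exact this
  obtain ⟨y, hy, z, hz, hyz⟩ := Subgroup.mem_sup_of_normal_left.1 hmem
  have hy0 : toAb _ (Additive.ofMul y) = 0 :=
    (QuotientGroup.eq_one_iff y).2 (Subgroup.le_topologicalClosure _ hy)
  have : toAb _ (Additive.ofMul v) = toAb _ (Additive.ofMul (u * z)) := by
    rw [← mul_inv_cancel_left u v, ← hyz, ofMul_mul, ofMul_mul, map_add, map_add, hy0, zero_add,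
      ofMul_mul, map_add]
  rw [← hv, this]
  exact hN hz

/-- The isomorphism induced by the reciprocity map. -/
theorem exists_equiv {U V : OpenSubgroup G} (hVU : (V : Subgroup G) ≤ U)
    [((V : Subgroup G).subgroupOf (U : Subgroup G)).Normal] :
    ∃ e : (H C (U : Subgroup G) 0 ⧸ (cor (C := C) hVU 0).range) ≃+
        Additive (Abelianization ((U : Subgroup G) ⧸ (V : Subgroup G).subgroupOf U)),
      ∀ a : H C (U : Subgroup G) 0,
        e (QuotientAddGroup.mk a) = abProj U V (F.reciprocity U a) := by
  let f := (abProj U V).comp (F.reciprocity U)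
  have hker : f.ker = (cor (C := C) hVU 0).range := by
    ext a
    exact F.abProj_reciprocity_eq_zero hVU a
  have hsurj : Function.Surjective f := by
    intro t
    obtain ⟨q, hq⟩ := QuotientGroup.mk_surjective t.toMul
    obtain ⟨u, rfl⟩ := QuotientGroup.mk_surjective q
    obtain ⟨a, ha⟩ := F.exists_abProj_reciprocity_eq hVU u
    exact ⟨a, ha.trans hq⟩
  exact ⟨(QuotientAddGroup.quotientAddEquivOfEq hker.symm).trans
    (QuotientAddGroup.quotientKerEquivOfSurjective f hsurj), fun a => rfl⟩

end GeneralizedClassFormation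

end Main

end Hyper

end

open Hyper in
theorem mainTheorem3 {G : Type u} [Group G] [TopologicalSpace G] [IsTopologicalGroup G]
    [CompactSpace G] [TotallyDisconnectedSpace G]
    (C : CochainComplex (Rep.{w} ℤ G) ℤ) (hbounded : IsBounded C) (hdiscrete : IsDiscrete C)
    (F : GeneralizedClassFormation C) :
    ∃ ρ : ∀ U : OpenSubgroup G, H C (U : Subgroup G) 0 →+ Ab (U : Subgroup G),
      (∀ U : OpenSubgroup G, F.IsReciprocityMap U (ρ U) ∧
        ∀ ρ' : H C (U : Subgroup G) 0 →+ Ab (U : Subgroup G),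
          F.IsReciprocityMap U ρ' → ρ' = ρ U) ∧
      (∀ U : OpenSubgroup G, DenseRange (ρ U)) ∧
      ∀ (U V : OpenSubgroup G) (hVU : (V : Subgroup G) ≤ U)
        [((V : Subgroup G).subgroupOf U).Normal],
        ∃ e : (H C (U : Subgroup G) 0 ⧸ (cor (C := C) hVU 0).range) ≃+
            Additive (Abelianization ((U : Subgroup G) ⧸ (V : Subgroup G).subgroupOf U)),
          ∀ a : H C (U : Subgroup G) 0, e (QuotientAddGroup.mk a) = abProj U V (ρ U a) :=
  ⟨F.reciprocity, fun U => ⟨F.isReciprocityMap_reciprocity U, fun _ => F.eq_reciprocity⟩,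
    F.denseRange_reciprocity, fun _ _ hVU => F.exists_equiv hVU⟩
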